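/- **Conventions.** Let $\mathbb H$ be the upper half plane, $\Gamma(M)\subseteq SL_2(\mathbb Z)$ ($M\ge 1$) the principal congruence subgroups, $q=e^{2\pi i z}$, and $(f|_k\gamma)(z)=(cz+d)^{-k}f(\gamma z)$ for $\gamma=\begin{pmatrix}a&b\\c&d\end{pmatrix}\in SL_2(\mathbb Z)$. Vector spaces, Lie algebras and tensor products are over $\mathbb C$. *Quasimodular tower.* Let $\mathcal M_k$ be the space of all modular forms of weight $k\in\mathbb Z$ and any level $\Gamma(M)$, $M\ge1$. A holomorphic $f:\mathbb H\to\mathbb C$ is quasimodular of level $\Gamma(M)$, weight $k$ and depth $s$ if there are functions $f_0,\dots,f_s$ on $\mathbb H$, $f_s\neq0$, with $f_j$ holomorphic on $\mathbb H$ and at the cusps (that is, $f_j|_{k-2j}\delta$ is bounded as $\operatorname{Im}z\to\infty$ for every $\delta\in SL_2(\mathbb Z)$), such that $(f|_k\gamma)(z)=\sum_{j=0}^s f_j(z)\left(\frac{c}{cz+d}\right)^j$ for all $\gamma=\begin{pmatrix}a&b\\c&d\end{pmatrix}\in\Gamma(M)$ and $z\in\mathbb H$. Let $\mathcal{QM}_k$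 be the space consisting of $0$ and all quasimodular forms of weight $k$, any depth and any level, and let $\mathcal{QM}=\bigoplus_{k\ge0}\mathcal{QM}_k$, a commutative graded algebra. With $G_2=-\frac1{24}+\sum_{n\ge1}\left(\sum_{d\mid n}d\right)q^n$, each $f\in\mathcal{QM}_k$ is uniquely a finite sum $f=\sum_{i\ge0}a_i(f)G_2^i$ with $a_i(f)\in\mathcal M_{k-2i}$. For $\gamma\in SL_2(\mathbb Z)$ and $f\in\mathcal{QM}_k$ put $$f\|\gamma=\sum_i \big(a_i(f)|_{k-2i}\gamma\big)G_2^i,\qquad X(f)=\sum_i X(a_i(f))G_2^i,\qquad Y(f)=\sum_i Y(a_i(f))G_2^i,$$ where for $g\in\mathcal M_w$ we set $Y(g)=\frac w2g$ and $X(g)=\frac1{2\pi i}\frac{dg}{dz}-\frac1{12\pi i}\frac{d\log\Delta}{dz}\,Y(g)$, with $\Delta=(2\pi)^{12}q\prod_{n\ge1}(1-q^n)^{24}$; extend these operations linearly to $\mathcal{QM}$. *Twisted Hecke operators.* Let $\Gamma=\Gamma(N)$ with $N\ge1$, and let $\sigma\in SL_2(\mathbb Z)$. For $\sigma'\in SL_2(\mathbb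 Z)$ let $\mathcal Q_{\sigma'}(\Gamma)$ be the space of functions $F:\Gamma\backslash GL_2^+(\mathbb Q)\to\mathcal{QM}$, $\Gamma\alpha\mapsto F_\alpha$, of finite support such that $F_{\alpha\gamma}=F_\alpha\|\sigma'\gamma\sigma'^{-1}$ for all $\alpha\in GL_2^+(\mathbb Q)$, $\gamma\in\Gamma$. For $m\in\mathbb Z$ let $\rho_m=\begin{pmatrix}1&m\\0&1\end{pmatrix}$ and $\sigma(m)=\rho_m\sigma$, and let $\mathbb Q_\sigma(\Gamma)=\bigoplus_{m\in\mathbb Z}\mathcal Q_{\sigma(m)}(\Gamma)$. Define on $\mathbb Q_\sigma(\Gamma)$, for $F\in\mathcal Q_{\sigma(m)}(\Gamma)$ and $n\in\mathbb Z$, the operators $$X_n(F)_\alpha=X(F_\alpha)\|\rho_n^{-1},\quad X_n(F)\in\mathcal Q_{\sigma(m+n)}(\Gamma);\qquad Z(F)_\alpha=mF_\alpha+Y(F_\alpha),\quad Z(F)\in\mathcal Q_{\sigma(m)}(\Gamma),$$ and the bilinear pairing $(\ ,\ )$ on $\mathbb Q_\sigma(\Gamma)$ given, for $F^1\in\mathcal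 Q_{\sigma(m)}(\Gamma)$ and $F^2\in\mathcal Q_{\sigma(n)}(\Gamma)$, by the element $(F^1,F^2)\in\mathcal Q_{\sigma(m+n)}(\Gamma)$ with $$(F^1,F^2)_\alpha=\sum_{\beta\in\Gamma\backslash SL_2(\mathbb Z)}\big(F^1_{\beta\sigma}\|\rho_n^{-1}\big)\cdot\big(F^2_{\alpha\sigma^{-1}\beta^{-1}}\|\rho_n\sigma\beta\rho_m^{-1}\rho_n^{-1}\big).$$ *The Hopf algebra.* Let $\mathfrak l_{\mathbb Z}$ be the Lie algebra with generators $Z$, $X_n$ ($n\in\mathbb Z$) and relations $[Z,X_n]=(n+1)X_n$ and $[X_n,X_{n'}]=0$ ($n,n'\in\mathbb Z$). Let $\mathfrak h_{\mathbb Z}$ be its universal enveloping algebra, with its usual Hopf algebra structure, so that its coproduct $\Delta_{\mathfrak h}$ satisfies $\Delta_{\mathfrak h}(x)=x\otimes1+1\otimes x$ for $x\in\mathfrak l_{\mathbb Z}$; write $\Delta_{\mathfrak h}(h)=\sum h_{(1)}\otimes h_{(2)}$. **Theorem.** For every $N\ge 1$ and $\sigma\in SL_2(\mathbb Z)$, with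 $\Gamma=\Gamma(N)$, there is an action of the algebra $\mathfrak h_{\mathbb Z}$ on $\mathbb Q_\sigma(\Gamma)$ in which the generators $X_n$ and $Z$ act as the operators $X_n$ and $Z$ above, and it is a Hopf action on the pairing: $$h(F^1,F^2)=\sum\big(h_{(1)}(F^1),h_{(2)}(F^2)\big)\qquad\text{for all }h\in\mathfrak h_{\mathbb Z},\ F^1,F^2\in\mathbb Q_\sigma(\Gamma).$$ In particular $X_n(F^1,F^2)=(X_n(F^1),F^2)+(F^1,X_n(F^2))$ for all $n\in\mathbb Z$, and $Z(F^1,F^2)=(Z(F^1),F^2)+(F^1,Z(F^2))$. -/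

import Mathlib

open scoped UpperHalfPlane MatrixGroups ModularForm Manifold DirectSum TensorProduct Polynomial

noncomputable section

namespace QuasiHecke

open UpperHalfPlane (IsBoundedAtImInfty)

/-! ### The modular tower -/

/-- `f` is a modular form of weight `w` for the principal congruence subgroup `Γ(N)`. -/
def IsModular (N : ℕ) (w : ℤ) (f : ℍ → ℂ) : Prop :=
  ∃ g : ModularForm (CongruenceSubgroup.Gamma N : Subgroup (GL (Fin 2) ℝ)) w, ⇑g = f

/-- `f` is holomorphic and, for the weight `w` slash action, bounded at every cusp. -/
def HoloBdd (w : ℤ) (f : ℍ → ℂ) : Prop :=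
  MDiff f ∧ ∀ δ : SL(2, ℤ), IsBoundedAtImInfty (f ∣[w] δ)

lemma isModular_iff {N : ℕ} [NeZero N] {w : ℤ} {f : ℍ → ℂ} :
    IsModular N w f ↔
      HoloBdd w f ∧ ∀ γ ∈ CongruenceSubgroup.Gamma N, f ∣[w] γ = f := by
  constructor
  · rintro ⟨g, rfl⟩
    refine ⟨⟨g.holo', fun δ => ?_⟩, fun γ hγ => ?_⟩
    · have hc : IsCusp ((Matrix.SpecialLinearGroup.mapGL ℝ δ) • OnePoint.infty)
          (CongruenceSubgroup.Gamma N : Subgroup (GL (Fin 2) ℝ)) := by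
        rw [Subgroup.IsArithmetic.isCusp_iff_isCusp_SL2Z, isCusp_SL2Z_iff']
        exact ⟨δ, rfl⟩
      exact g.bdd_at_cusps' hc _ rfl
    · exact g.slash_action_eq' _ ⟨γ, hγ, rfl⟩
  · rintro ⟨⟨h1, h2⟩, h3⟩
    refine ⟨⟨⟨f, ?_⟩, h1, ?_⟩, rfl⟩
    · rintro _ ⟨γ, hγ, rfl⟩
      exact h3 γ hγ
    · intro c hc
      rw [Subgroup.IsArithmetic.isCusp_iff_isCusp_SL2Z] at hc
      rw [OnePoint.isBoundedAt_iff_forall_SL2Z hc]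
      exact fun γ _ => h2 γ

lemma HoloBdd.zero (w : ℤ) : HoloBdd w 0 :=
  ⟨mdifferentiable_const, fun δ => by
    simpa using UpperHalfPlane.zero_form_isBoundedAtImInfty⟩

lemma HoloBdd.add {w : ℤ} {f g : ℍ → ℂ} (hf : HoloBdd w f) (hg : HoloBdd w g) :
    HoloBdd w (f + g) :=
  ⟨hf.1.add hg.1, fun δ => by
    rw [SlashAction.add_slash]; exact (hf.2 δ).add (hg.2 δ)⟩

lemma HoloBdd.smul {w : ℤ} {f : ℍ → ℂ} (c : ℂ) (hf : HoloBdd w f) :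
    HoloBdd w (c • f) :=
  ⟨hf.1.const_smul c, fun δ => by
    rw [ModularForm.SL_smul_slash]; exact (hf.2 δ).const_smul_left c⟩

lemma HoloBdd.mul {v w : ℤ} {f g : ℍ → ℂ} (hf : HoloBdd v f) (hg : HoloBdd w g) :
    HoloBdd (v + w) (f * g) :=
  ⟨hf.1.mul hg.1, fun δ => by
    rw [ModularForm.mul_slash_SL2]; exact (Filter.BoundedAtFilter.mul (hf.2 δ) (hg.2 δ))⟩

lemma HoloBdd.sum {ι : Type*} {w : ℤ} (s : Finset ι) (f : ι → ℍ → ℂ)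
    (h : ∀ i ∈ s, HoloBdd w (f i)) : HoloBdd w (∑ i ∈ s, f i) :=
  Finset.sum_induction f (HoloBdd w) (fun _ _ => HoloBdd.add) (HoloBdd.zero w) h

lemma HoloBdd.one : HoloBdd 0 1 :=
  ⟨mdifferentiable_const, fun δ => by
    rw [ModularForm.is_invariant_one]
    exact Filter.const_boundedAtFilter _ (1 : ℂ)⟩

lemma HoloBdd.slash {w : ℤ} {f : ℍ → ℂ} (hf : HoloBdd w f) (γ : SL(2, ℤ)) :
    HoloBdd w (f ∣[w] γ) :=
  ⟨hf.1.slash w _, fun δ => by rw [← SlashAction.slash_mul]; exact hf.2 _⟩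

lemma Gamma_le_of_dvd {N M : ℕ} (h : N ∣ M) :
    CongruenceSubgroup.Gamma M ≤ CongruenceSubgroup.Gamma N := by
  intro γ hγ
  rw [CongruenceSubgroup.Gamma_mem] at hγ ⊢
  have key : ∀ a b : ℤ, (a : ZMod M) = b → (a : ZMod N) = b := by
    intro a b hab
    rw [ZMod.intCast_eq_intCast_iff_dvd_sub] at hab ⊢
    exact dvd_trans (by exact_mod_cast h) hab
  have k1 := key _ 1 (by simpa using hγ.1)
  have k2 := key _ 0 (by simpa using hγ.2.1)
  have k3 := key _ 0 (by simpa using hγ.2.2.1)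
  have k4 := key _ 1 (by simpa using hγ.2.2.2)
  exact ⟨by simpa using k1, by simpa using k2, by simpa using k3, by simpa using k4⟩

lemma IsModular.level_mono {N M : ℕ} [NeZero N] [NeZero M] (h : N ∣ M) {w : ℤ} {f : ℍ → ℂ}
    (hf : IsModular N w f) : IsModular M w f := by
  rw [isModular_iff] at hf ⊢
  exact ⟨hf.1, fun γ hγ => hf.2 γ (Gamma_le_of_dvd h hγ)⟩

/-- The weight `w` part of the modular tower: modular forms of weight `w` and any level
`Γ(N)`, `N ≥ 1`. -/
def modTower (w : ℤ) : Submodule ℂ (ℍ → ℂ) where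
  carrier := {f | ∃ N : ℕ, N ≠ 0 ∧ IsModular N w f}
  zero_mem' := ⟨1, one_ne_zero, isModular_iff.2 ⟨HoloBdd.zero w, fun _ _ => by simp⟩⟩
  add_mem' := by
    rintro f g ⟨N, hN, hf⟩ ⟨M, hM, hg⟩
    have : NeZero N := ⟨hN⟩
    have : NeZero M := ⟨hM⟩
    have hf := isModular_iff.1 (hf.level_mono (Dvd.intro M rfl : N ∣ N * M))
    have hg := isModular_iff.1 (hg.level_mono (Dvd.intro_left N rfl : M ∣ N * M))
    refine ⟨N * M, mul_ne_zero hN hM, isModular_iff.2 ⟨hf.1.add hg.1, fun γ hγ => ?_⟩⟩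
    rw [SlashAction.add_slash, hf.2 γ hγ, hg.2 γ hγ]
  smul_mem' := by
    rintro c f ⟨N, hN, hf⟩
    have : NeZero N := ⟨hN⟩
    have hf := isModular_iff.1 hf
    refine ⟨N, hN, isModular_iff.2 ⟨hf.1.smul c, fun γ hγ => ?_⟩⟩
    rw [ModularForm.SL_smul_slash, hf.2 γ hγ]

lemma mem_modTower {w : ℤ} {f : ℍ → ℂ} : f ∈ modTower w ↔ ∃ N : ℕ, N ≠ 0 ∧ IsModular N w f :=
  Iff.rfl

lemma modTower_mul {v w : ℤ} {f g : ℍ → ℂ} (hf : f ∈ modTower v) (hg : g ∈ modTower w) :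
    f * g ∈ modTower (v + w) := by
  obtain ⟨N, hN, hf⟩ := hf
  obtain ⟨M, hM, hg⟩ := hg
  have : NeZero N := ⟨hN⟩
  have : NeZero M := ⟨hM⟩
  have hf := isModular_iff.1 (hf.level_mono (Dvd.intro M rfl : N ∣ N * M))
  have hg := isModular_iff.1 (hg.level_mono (Dvd.intro_left N rfl : M ∣ N * M))
  refine ⟨N * M, mul_ne_zero hN hM, isModular_iff.2 ⟨hf.1.mul hg.1, fun γ hγ => ?_⟩⟩
  rw [ModularForm.mul_slash_SL2, hf.2 γ hγ, hg.2 γ hγ]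

lemma modTower_slash {w : ℤ} {f : ℍ → ℂ} (hf : f ∈ modTower w) (δ : SL(2, ℤ)) :
    f ∣[w] δ ∈ modTower w := by
  obtain ⟨N, hN, hf⟩ := hf
  have : NeZero N := ⟨hN⟩
  have hf := isModular_iff.1 hf
  refine ⟨N, hN, isModular_iff.2 ⟨hf.1.slash δ, fun γ hγ => ?_⟩⟩
  have h := hf.2 (δ * γ * δ⁻¹) ((CongruenceSubgroup.Gamma_normal N).conj_mem γ hγ δ)
  calc (f ∣[w] δ) ∣[w] γ = f ∣[w] (δ * γ * δ⁻¹ * δ) := by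
        rw [← SlashAction.slash_mul]; congr 1; group
    _ = f ∣[w] δ := by rw [SlashAction.slash_mul, h]

/-! ### Quasimodular forms -/

/-- The quantity `c / (c z + d)` attached to `γ = (a, b; c, d)`. -/
def cRatio (γ : SL(2, ℤ)) (z : ℍ) : ℂ :=
  ((γ 1 0 : ℤ) : ℂ) / (((γ 1 0 : ℤ) : ℂ) * z + ((γ 1 1 : ℤ) : ℂ))

/-- `f` is a quasimodular form of level `Γ(N)`, weight `k` and depth exactly `s`. As for
modular forms, the component functions `F j`, which have weight `k - 2 j`, are required to be
holomorphic on `ℍ` and at the cusps. -/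
def IsQuasimodular (N : ℕ) (k : ℤ) (s : ℕ) (f : ℍ → ℂ) : Prop :=
  MDiff f ∧ ∃ F : Fin (s + 1) → ℍ → ℂ,
    (∀ j, MDiff (F j)) ∧
    (∀ (j : Fin (s + 1)) (δ : SL(2, ℤ)),
      IsBoundedAtImInfty (F j ∣[k - 2 * ((j : ℕ) : ℤ)] δ)) ∧
    F (Fin.last s) ≠ 0 ∧
    ∀ γ ∈ CongruenceSubgroup.Gamma N, ∀ z : ℍ,
      (f ∣[k] γ) z = ∑ j : Fin (s + 1), F j z * cRatio γ z ^ (j : ℕ)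

/-- Auxiliary: the component functions organised as a polynomial. -/
def HasPoly (N : ℕ) (k : ℤ) (p : (ℍ → ℂ)[X]) (f : ℍ → ℂ) : Prop :=
  (∀ j : ℕ, HoloBdd (k - 2 * (j : ℤ)) (p.coeff j)) ∧
    ∀ γ ∈ CongruenceSubgroup.Gamma N, ∀ z : ℍ,
      (f ∣[k] γ) z = p.eval₂ (Pi.evalRingHom (fun _ : ℍ => ℂ) z) (cRatio γ z)

lemma HasPoly.add {N : ℕ} {k : ℤ} {p q : (ℍ → ℂ)[X]} {f g : ℍ → ℂ}
    (hf : HasPoly N k p f) (hg : HasPoly N k q g) : HasPoly N k (p + q) (f + g) :=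
  ⟨fun j => by rw [Polynomial.coeff_add]; exact (hf.1 j).add (hg.1 j), fun γ hγ z => by
    rw [SlashAction.add_slash, Pi.add_apply, hf.2 γ hγ, hg.2 γ hγ, Polynomial.eval₂_add]⟩

lemma HasPoly.smul {N : ℕ} {k : ℤ} {p : (ℍ → ℂ)[X]} {f : ℍ → ℂ} (c : ℂ)
    (hf : HasPoly N k p f) : HasPoly N k (c • p) (c • f) :=
  ⟨fun j => by rw [Polynomial.coeff_smul]; exact (hf.1 j).smul c, fun γ hγ z => by
    rw [ModularForm.SL_smul_slash, Pi.smul_apply, hf.2 γ hγ, Polynomial.eval₂_eq_sum_range' _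
      (Nat.lt_succ_iff.2 (Polynomial.natDegree_smul_le c p)),
      Polynomial.eval₂_eq_sum_range, smul_eq_mul, Finset.mul_sum]
    exact Finset.sum_congr rfl fun i _ => by simp [mul_assoc]⟩

lemma HasPoly.mul {N : ℕ} {k l : ℤ} {p q : (ℍ → ℂ)[X]} {f g : ℍ → ℂ}
    (hf : HasPoly N k p f) (hg : HasPoly N l q g) : HasPoly N (k + l) (p * q) (f * g) :=
  ⟨fun j => by
    rw [Polynomial.coeff_mul]
    refine HoloBdd.sum _ _ fun x hx => ?_
    have := (hf.1 x.1).mul (hg.1 x.2)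
    rw [Finset.HasAntidiagonal.mem_antidiagonal] at hx
    rwa [show k - 2 * (x.1 : ℤ) + (l - 2 * (x.2 : ℤ)) = k + l - 2 * (j : ℤ) by
      rw [← hx]; push_cast; ring] at this,
   fun γ hγ z => by
    rw [ModularForm.mul_slash_SL2, Pi.mul_apply, hf.2 γ hγ, hg.2 γ hγ, Polynomial.eval₂_mul]⟩

lemma HasPoly.level_mono {N M : ℕ} (h : N ∣ M) {k : ℤ} {p : (ℍ → ℂ)[X]} {f : ℍ → ℂ}
    (hf : HasPoly N k p f) : HasPoly M k p f :=
  ⟨hf.1, fun γ hγ z => hf.2 γ (Gamma_le_of_dvd h hγ) z⟩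

lemma HasPoly.eq_coeff_zero {N : ℕ} {k : ℤ} {p : (ℍ → ℂ)[X]} {f : ℍ → ℂ}
    (hf : HasPoly N k p f) : f = p.coeff 0 := by
  ext z
  have := hf.2 1 (one_mem _) z
  rw [SlashAction.slash_one] at this
  rw [this]
  simp [cRatio, Polynomial.eval₂_at_zero]

lemma hasPoly_of_isModular {N : ℕ} [NeZero N] {k : ℤ} {f : ℍ → ℂ} (hf : IsModular N k f) :
    HasPoly N k (Polynomial.C f) f := by
  rw [isModular_iff] at hf
  refine ⟨fun j => ?_, fun γ hγ z => by simp [hf.2 γ hγ]⟩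
  rw [Polynomial.coeff_C]
  split_ifs with h
  · simpa [h] using hf.1
  · exact HoloBdd.zero _

lemma hasPoly_iff {N : ℕ} {k : ℤ} {f : ℍ → ℂ} :
    (∃ p, HasPoly N k p f) ↔ (f = 0 ∨ ∃ s, IsQuasimodular N k s f) := by
  constructor
  · rintro ⟨p, hp⟩
    by_cases h0 : p = 0
    · left; rw [hp.eq_coeff_zero, h0]; simp
    · right
      refine ⟨p.natDegree, hp.eq_coeff_zero ▸ (hp.1 0).1, fun j => p.coeff j,
        fun j => (hp.1 j).1, fun j => (hp.1 j).2, ?_, fun γ hγ z => ?_⟩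
      · simpa using h0
      · rw [hp.2 γ hγ z, Polynomial.eval₂_eq_sum_range, Finset.sum_range]
        rfl
  · rintro (rfl | ⟨s, _, F, h1, h2, _, h4⟩)
    · exact ⟨0, fun j => by simpa using HoloBdd.zero _, fun γ _ z => by simp⟩
    · refine ⟨∑ j : Fin (s + 1), Polynomial.monomial (j : ℕ) (F j), fun j => ?_,
        fun γ hγ z => ?_⟩
      · rw [Polynomial.finsetSum_coeff]
        refine HoloBdd.sum _ _ fun i _ => ?_
        rw [Polynomial.coeff_monomial]
        split_ifs with h
        · subst h; exact ⟨h1 i, h2 i⟩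
        · exact HoloBdd.zero _
      · rw [h4 γ hγ z, Polynomial.eval₂_finsetSum]
        simp [Polynomial.eval₂_monomial]

lemma hasPoly_iff_exists {k : ℤ} {f : ℍ → ℂ} :
    (f = 0 ∨ ∃ N s : ℕ, N ≠ 0 ∧ IsQuasimodular N k s f) ↔
      ∃ N : ℕ, N ≠ 0 ∧ ∃ p, HasPoly N k p f := by
  simp only [hasPoly_iff]
  exact ⟨fun h => h.elim (fun h => ⟨1, one_ne_zero, Or.inl h⟩)
    fun ⟨N, s, hN, h⟩ => ⟨N, hN, Or.inr ⟨s, h⟩⟩,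
    fun ⟨N, hN, h⟩ => h.imp id fun ⟨s, h⟩ => ⟨N, s, hN, h⟩⟩

/-- The weight `k` part of the quasimodular tower: quasimodular forms of weight `k`, of any depth
and any level `Γ(N)`, `N ≥ 1`, together with the zero function. -/
def quasiTower (k : ℤ) : Submodule ℂ (ℍ → ℂ) where
  carrier := {f | f = 0 ∨ ∃ N s : ℕ, N ≠ 0 ∧ IsQuasimodular N k s f}
  zero_mem' := Or.inl rfl
  add_mem' := by
    intro f g hf hg
    obtain ⟨N, hN, p, hf⟩ := hasPoly_iff_exists.1 hf
    obtain ⟨M, hM, q, hg⟩ := hasPoly_iff_exists.1 hg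
    exact hasPoly_iff_exists.2 ⟨N * M, mul_ne_zero hN hM, p + q,
      (hf.level_mono (Dvd.intro M rfl)).add (hg.level_mono (Dvd.intro_left N rfl))⟩
  smul_mem' := by
    intro c f hf
    obtain ⟨N, hN, p, hf⟩ := hasPoly_iff_exists.1 hf
    exact hasPoly_iff_exists.2 ⟨N, hN, c • p, hf.smul c⟩

lemma mem_quasiTower {k : ℤ} {f : ℍ → ℂ} :
    f ∈ quasiTower k ↔ ∃ N : ℕ, N ≠ 0 ∧ ∃ p, HasPoly N k p f :=
  hasPoly_iff_exists

lemma quasiTower_mul {k l : ℤ} {f g : ℍ → ℂ} (hf : f ∈ quasiTower k) (hg : g ∈ quasiTower l) :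
    f * g ∈ quasiTower (k + l) := by
  obtain ⟨N, hN, p, hf⟩ := mem_quasiTower.1 hf
  obtain ⟨M, hM, q, hg⟩ := mem_quasiTower.1 hg
  exact mem_quasiTower.2 ⟨N * M, mul_ne_zero hN hM, p * q,
    (hf.level_mono (Dvd.intro M rfl)).mul (hg.level_mono (Dvd.intro_left N rfl))⟩

lemma modTower_le_quasiTower (k : ℤ) : modTower k ≤ quasiTower k := by
  rintro f ⟨N, hN, hf⟩
  have : NeZero N := ⟨hN⟩
  exact mem_quasiTower.2 ⟨N, hN, _, hasPoly_of_isModular hf⟩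

/-! ### The Eisenstein series of weight two and the structure of quasimodular forms -/

/-- The Eisenstein series `G₂ = -B₂/4 + ∑ σ₁(n) qⁿ`, with `B₂ = 1/6` and `q = exp (2πiz)`. -/
def eisG2 (z : ℍ) : ℂ :=
  -(bernoulli 2 : ℂ) / (2 * 2) + ∑' n : ℕ+, ((ArithmeticFunction.sigma 1 (n : ℕ) : ℕ) : ℂ) *
    Complex.exp (2 * Real.pi * Complex.I * (n : ℕ) * z)

lemma eisG2_eq : eisG2 = (-(1 / 24) : ℂ) • EisensteinSeries.E2 := by
  ext z
  simp only [eisG2, Pi.smul_apply, smul_eq_mul, EisensteinSeries.E2_eq_tsum_cexp, bernoulli_two]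
  have : ∀ n : ℕ+, Complex.exp (2 * Real.pi * Complex.I * (n : ℕ) * z) =
      Complex.exp (2 * Real.pi * Complex.I * z) ^ (n : ℕ) := by
    intro n; rw [← Complex.exp_nat_mul]; congr 1; ring
  simp only [this]
  push_cast
  ring

lemma denom_eq (γ : SL(2, ℤ)) (z : ℍ) : UpperHalfPlane.denom (γ : GL (Fin 2) ℝ) z =
    ((γ 1 0 : ℤ) : ℂ) * z + ((γ 1 1 : ℤ) : ℂ) := ModularGroup.denom_apply γ z

lemma cRatio_eq (γ : SL(2, ℤ)) (z : ℍ) :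
    EisensteinSeries.D2 γ z = 2 * Real.pi * Complex.I * cRatio γ z := by
  simp only [EisensteinSeries.D2, cRatio, denom_eq]
  ring

/-- The constant in the transformation law of `G₂`. -/
def cG2 : ℂ := (1 / 24) * (1 / (2 * riemannZeta 2)) * (2 * Real.pi * Complex.I)

lemma cG2_ne : cG2 ≠ 0 := by
  simp [cG2, riemannZeta_two, Real.pi_ne_zero]

lemma eisG2_slash (γ : SL(2, ℤ)) : eisG2 ∣[(2 : ℤ)] γ = eisG2 + cG2 • cRatio γ := by
  rw [eisG2_eq, ModularForm.SL_smul_slash, EisensteinSeries.E2_slash_action]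
  ext z
  simp only [Pi.smul_apply, Pi.sub_apply, Pi.add_apply, cRatio_eq, smul_eq_mul, cG2]
  ring

lemma cRatio_mul (γ δ : SL(2, ℤ)) (z : ℍ) : cRatio (γ * δ) z =
    cRatio γ (δ • z) * UpperHalfPlane.denom (δ : GL (Fin 2) ℝ) z ^ (-2 : ℤ) + cRatio δ z := by
  have h := congrFun (EisensteinSeries.D2_mul γ δ) z
  rw [Pi.add_apply, ModularForm.SL_slash_apply, cRatio_eq, cRatio_eq, cRatio_eq] at h
  have h2 : (2 * Real.pi * Complex.I : ℂ) ≠ 0 := by simp [Real.pi_ne_zero]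
  apply mul_left_cancel₀ h2
  rw [h]; ring

lemma infinite_cRatio (N : ℕ) (hN : N ≠ 0) (z : ℍ) :
    {t : ℂ | ∃ γ ∈ CongruenceSubgroup.Gamma N, cRatio γ z = t}.Infinite := by
  let g : ℕ → SL(2, ℤ) := fun n => ⟨!![1, 0; (N : ℤ) * n, 1], by simp [Matrix.det_fin_two]⟩
  refine Set.infinite_of_injective_forall_mem (f := fun n => cRatio (g n) z) ?_ ?_
  · intro m n h
    have hd : ∀ n : ℕ, ((N : ℂ) * n * z + 1) ≠ 0 := by
      intro n hn
      have := UpperHalfPlane.denom_ne_zero (g n : GL (Fin 2) ℝ) z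
      rw [denom_eq] at this
      apply this
      simpa [g] using hn
    have hmn : (N : ℂ) * m / ((N : ℂ) * m * z + 1) = (N : ℂ) * n / ((N : ℂ) * n * z + 1) := by
      simpa [cRatio, g] using h
    rw [div_eq_div_iff (hd m) (hd n)] at hmn
    have : (N : ℂ) * m = N * n := by linear_combination hmn
    have := mul_left_cancel₀ (by exact_mod_cast hN) this
    exact_mod_cast this
  · intro n
    refine ⟨g n, ?_, rfl⟩
    rw [CongruenceSubgroup.Gamma_mem]
    simp [g]

/-- Auxiliary: the components of `G₂`. -/
def polyG2 : (ℍ → ℂ)[X] :=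
  Polynomial.C eisG2 + Polynomial.C (Function.const ℍ cG2) * Polynomial.X

lemma hasPoly_G2 (N : ℕ) : HasPoly N 2 polyG2 eisG2 := by
  have hE : HoloBdd 2 eisG2 := by
    refine ⟨?_, fun δ => ?_⟩
    · rw [eisG2_eq]
      exact E2_mdifferentiable.const_smul _
    · rw [eisG2_slash]
      refine Filter.BoundedAtFilter.add ?_ (Asymptotics.IsBigO.const_smul_left ?_ _)
      · rw [eisG2_eq]
        exact EisensteinSeries.isBoundedAtImInfty_E2.const_smul_left _
      · change IsBoundedAtImInfty _
        rw [UpperHalfPlane.isBoundedAtImInfty_iff]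
        refine ⟨1, 1, fun z hz => ?_⟩
        rw [cRatio]
        by_cases hc : (δ 1 0 : ℤ) = 0
        · simp [hc]
        rw [norm_div]
        have h1 : ‖((δ 1 0 : ℤ) : ℂ)‖ ≤ ‖((δ 1 0 : ℤ) : ℂ) * z + ((δ 1 1 : ℤ) : ℂ)‖ := by
          refine le_trans ?_ (Complex.abs_im_le_norm _)
          have : ((z : ℂ)).im = z.im := rfl
          simp only [Complex.add_im, Complex.mul_im, Complex.intCast_re, Complex.intCast_im,
            zero_mul, add_zero, abs_mul, Complex.norm_intCast, this]
          exact le_mul_of_one_le_right (abs_nonneg _) (le_trans hz (le_abs_self _))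
        exact div_le_one_of_le₀ h1 (norm_nonneg _)
  refine ⟨fun j => ?_, fun γ hγ z => ?_⟩
  · rw [polyG2, Polynomial.coeff_add, Polynomial.coeff_C_mul, Polynomial.coeff_C,
      Polynomial.coeff_X]
    rcases j with _ | _ | j
    · simpa using hE
    · have h1 : Function.const ℍ cG2 = cG2 • (1 : ℍ → ℂ) := by ext; simp
      simpa [h1] using HoloBdd.one.smul cG2
    · simpa using HoloBdd.zero _
  · rw [eisG2_slash]
    simp [polyG2, Polynomial.eval₂_add, Polynomial.eval₂_mul]

lemma hasPoly_G2_pow (N : ℕ) (i : ℕ) :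
    HasPoly N (2 * (i : ℤ)) (polyG2 ^ i) (eisG2 ^ i) := by
  induction i with
  | zero =>
    refine ⟨fun j => ?_, fun γ hγ z => ?_⟩
    · rw [pow_zero, Polynomial.coeff_one]
      split_ifs with h
      · simpa [h] using HoloBdd.one
      · exact HoloBdd.zero _
    · simp only [pow_zero, Polynomial.eval₂_one]
      simpa using congrFun (ModularForm.is_invariant_one γ) z
  | succ i ih =>
    have := ih.mul (hasPoly_G2 N)
    rw [pow_succ, pow_succ]
    convert this using 1
    push_cast; ring

lemma HasPoly.top_modular {N : ℕ} [NeZero N] {k : ℤ} {p : (ℍ → ℂ)[X]} {f : ℍ → ℂ}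
    (hf : HasPoly N k p f) {s : ℕ} (hs : p.degree < ((s + 1 : ℕ) : WithBot ℕ)) :
    IsModular N (k - 2 * (s : ℤ)) (p.coeff s) := by
  rw [isModular_iff]
  refine ⟨hf.1 s, fun δ hδ => ?_⟩
  ext z
  set x := cRatio δ z
  -- both sides as polynomials in `T`
  let P : ℂ[X] := ∑ j ∈ Finset.range (s + 1), Polynomial.C (p.coeff j z) * Polynomial.X ^ j
  let Q : ℂ[X] := ∑ j ∈ Finset.range (s + 1),
    Polynomial.C ((p.coeff j ∣[k - 2 * (j : ℤ)] δ) z) * (Polynomial.X + Polynomial.C (-x)) ^ j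
  have hev : ∀ (t : ℂ) (w : ℍ), p.eval₂ (Pi.evalRingHom (fun _ : ℍ => ℂ) w) t =
      ∑ j ∈ Finset.range (s + 1), p.coeff j w * t ^ j := by
    intro t w
    by_cases h0 : p = 0
    · simp [h0]
    · rw [Polynomial.eval₂_eq_sum_range' _
        ((Polynomial.natDegree_lt_iff_degree_lt h0).2 hs)]
      rfl
  have hPQ : P = Q := by
    apply Polynomial.eq_of_infinite_eval_eq
    refine (infinite_cRatio N (NeZero.ne N) z).mono ?_
    rintro t ⟨γ', hγ', rfl⟩
    obtain ⟨γ, hγ, rfl⟩ : ∃ γ ∈ CongruenceSubgroup.Gamma N, γ' = γ * δ :=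
      ⟨γ' * δ⁻¹, mul_mem hγ' (inv_mem hδ), by group⟩
    have h1 := hf.2 (γ * δ) hγ' z
    rw [SlashAction.slash_mul, ModularForm.SL_slash_apply, hf.2 γ hγ, hev, hev] at h1
    change Polynomial.eval _ P = Polynomial.eval _ Q
    simp only [P, Q, Polynomial.eval_finsetSum, Polynomial.eval_mul, Polynomial.eval_C,
      Polynomial.eval_pow, Polynomial.eval_X, Polynomial.eval_add]
    rw [← h1, Finset.sum_mul]
    refine Finset.sum_congr rfl fun j _ => ?_
    have hd := UpperHalfPlane.denom_ne_zero (δ : GL (Fin 2) ℝ) z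
    rw [cRatio_mul, ModularForm.SL_slash_apply, add_neg_cancel_right, mul_pow,
      ← zpow_natCast, ← zpow_natCast, ← zpow_mul]
    have : UpperHalfPlane.denom (δ : GL (Fin 2) ℝ) z ^ (-k) =
        UpperHalfPlane.denom (δ : GL (Fin 2) ℝ) z ^ (-(k - 2 * (j : ℤ))) *
          UpperHalfPlane.denom (δ : GL (Fin 2) ℝ) z ^ (-2 * (j : ℤ)) := by
      rw [← zpow_add₀ hd]; congr 1; ring
    rw [this]; ring
  have hc := congrArg (fun R => Polynomial.coeff R s) hPQ
  have hP : P.coeff s = p.coeff s z := by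
    simp [P, Polynomial.finsetSum_coeff, Polynomial.coeff_C_mul, Polynomial.coeff_X_pow]
  have hQ : Q.coeff s = (p.coeff s ∣[k - 2 * (s : ℤ)] δ) z := by
    simp only [Q, Polynomial.finsetSum_coeff, Polynomial.coeff_C_mul,
      Polynomial.coeff_X_add_C_pow]
    rw [Finset.sum_eq_single s]
    · simp
    · intro j hj hjs
      have : j < s := by have := Finset.mem_range.1 hj; omega
      simp [Nat.choose_eq_zero_of_lt this]
    · simp
  simp only [hP, hQ] at hc
  exact hc.symm

/-- Multiplication by `G₂ ^ i`, as a map from modular forms of weight `k - 2 i` to quasimodular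
forms of weight `k`. -/
def expandComp (k : ℤ) (i : ℕ) : modTower (k - 2 * (i : ℤ)) →ₗ[ℂ] quasiTower k where
  toFun a := ⟨(a : ℍ → ℂ) * eisG2 ^ i, by
    have h1 := modTower_le_quasiTower _ a.2
    have h2 : eisG2 ^ i ∈ quasiTower (2 * (i : ℤ)) :=
      mem_quasiTower.2 ⟨1, one_ne_zero, _, hasPoly_G2_pow 1 i⟩
    have := quasiTower_mul h1 h2
    rwa [sub_add_cancel] at this⟩
  map_add' a b := Subtype.ext (add_mul _ _ _)
  map_smul' c a := Subtype.ext (smul_mul_assoc c _ _)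

/-- The map `(a_i) ↦ ∑ a_i G₂ ^ i`. -/
def expandMap (k : ℤ) : (⨁ i : ℕ, modTower (k - 2 * (i : ℤ))) →ₗ[ℂ] quasiTower k :=
  DirectSum.toModule ℂ ℕ _ (expandComp k)

open scoped Classical in
lemma coe_expandMap (k : ℤ) (x : ⨁ i : ℕ, modTower (k - 2 * (i : ℤ))) (z : ℍ) :
    (expandMap k x : ℍ → ℂ) z =
      ∑ i ∈ DFinsupp.support x, (x i : ℍ → ℂ) z * eisG2 z ^ i := by
  conv_lhs => rw [← DirectSum.sum_support_of x]
  rw [map_sum, Submodule.coe_sum, Finset.sum_apply]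
  refine Finset.sum_congr rfl fun i _ => ?_
  change ((DirectSum.toModule ℂ ℕ _ (expandComp k) (DirectSum.lof ℂ ℕ _ i (x i)) :
    quasiTower k) : ℍ → ℂ) z = _
  rw [DirectSum.toModule_lof]
  rfl

lemma expandMap_injective (k : ℤ) : Function.Injective (expandMap k) := by
  classical
  rw [injective_iff_map_eq_zero]
  intro x hx
  have hlev : ∀ i : ℕ, ∃ N : ℕ, N ≠ 0 ∧ IsModular N (k - 2 * (i : ℤ)) (x i) :=
    fun i => (x i).2
  choose L hL0 hL using hlev
  set N := ∏ i ∈ DFinsupp.support x, L i with hN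
  have hN0 : N ≠ 0 := Finset.prod_ne_zero_iff.2 fun i _ => hL0 i
  have : NeZero N := ⟨hN0⟩
  ext i z
  by_contra hne
  have hi : i ∈ DFinsupp.support x := by
    rw [DFinsupp.mem_support_toFun]
    intro h; apply hne; rw [h]; rfl
  have hinv : ∀ γ ∈ CongruenceSubgroup.Gamma N, ∀ j ∈ DFinsupp.support x,
      (x j : ℍ → ℂ) ∣[k - 2 * (j : ℤ)] γ = x j := by
    intro γ hγ j hj
    have : NeZero (L j) := ⟨hL0 j⟩
    exact (isModular_iff.1 ((hL j).level_mono (Finset.dvd_prod_of_mem L hj))).2 γ hγ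
  let R : ℂ[X] := ∑ j ∈ DFinsupp.support x,
    Polynomial.C ((x j : ℍ → ℂ) z) * (Polynomial.X) ^ j
  have hR : R = 0 := by
    apply Polynomial.eq_zero_of_infinite_isRoot
    have hinf := (infinite_cRatio N hN0 z).image
      (f := fun t => eisG2 z + cG2 * t) (fun a _ b _ h => by simpa [cG2_ne] using h)
    refine hinf.mono ?_
    rintro _ ⟨_, ⟨γ, hγ, rfl⟩, rfl⟩
    have h0 : ((expandMap k x : ℍ → ℂ) ∣[k] γ) z = 0 := by rw [hx]; simp
    have hfun : (expandMap k x : ℍ → ℂ) =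
        ∑ j ∈ DFinsupp.support x, (x j : ℍ → ℂ) * eisG2 ^ j := by
      ext w; rw [coe_expandMap, Finset.sum_apply]; rfl
    rw [hfun, SlashAction.sum_slash, Finset.sum_apply] at h0
    change Polynomial.eval _ R = 0
    rw [← h0]
    simp only [R, Polynomial.eval_finsetSum, Polynomial.eval_mul, Polynomial.eval_C,
      Polynomial.eval_pow, Polynomial.eval_X]
    refine Finset.sum_congr rfl fun j hj => ?_
    have h1 := ModularForm.mul_slash_SL2 (k - 2 * (j : ℤ)) (2 * (j : ℤ)) γ (x j) (eisG2 ^ j)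
    rw [sub_add_cancel] at h1
    rw [h1, hinv γ hγ j hj, Pi.mul_apply, (hasPoly_G2_pow N j).2 γ hγ z]
    simp [polyG2, Polynomial.eval₂_pow, Polynomial.eval₂_add, Polynomial.eval₂_mul]
  have hc := congrArg (fun R => Polynomial.coeff R i) hR
  apply hne
  simpa [R, Polynomial.finsetSum_coeff, Polynomial.coeff_C_mul, Polynomial.coeff_X_pow,
    Finset.sum_ite_eq, hi] using hc

lemma mem_range_expandMap (k : ℤ) (N : ℕ) [NeZero N] (s : ℕ) : ∀ (p : (ℍ → ℂ)[X]) (f : ℍ → ℂ),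
    HasPoly N k p f → p.degree < (s : WithBot ℕ) →
      ∃ x, (expandMap k x : ℍ → ℂ) = f := by
  induction s with
  | zero =>
    intro p f hf hp
    have : p = 0 := by
      rw [← Polynomial.degree_eq_bot]; simpa using hp
    refine ⟨0, ?_⟩
    rw [hf.eq_coeff_zero, this]; simp
  | succ s ih =>
    intro p f hf hp
    have hm := hf.top_modular hp
    set a : ℍ → ℂ := p.coeff s with ha
    let a' : modTower (k - 2 * (s : ℤ)) := ⟨a, N, NeZero.ne N, hm⟩
    have hq := (hasPoly_of_isModular hm).mul (hasPoly_G2_pow N s)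
    rw [sub_add_cancel] at hq
    have hsub := hf.add (hq.smul (-(cG2 ^ s)⁻¹))
    obtain ⟨y, hy⟩ := ih _ _ hsub (by
      rw [Polynomial.degree_lt_iff_coeff_zero]
      intro m hms
      have hlin : polyG2.natDegree ≤ 1 := by
        rw [polyG2]
        compute_degree
      have hpow : (polyG2 ^ s).natDegree ≤ s := by
        simpa using Polynomial.natDegree_pow_le_of_le s hlin
      rw [Polynomial.coeff_add, Polynomial.coeff_smul, Polynomial.coeff_C_mul]
      rcases hms.eq_or_lt with rfl | hlt
      · have h1 : (polyG2 ^ s).coeff s = Function.const ℍ cG2 ^ s := by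
          have := Polynomial.coeff_pow_of_natDegree_le (m := s) hlin
          rw [mul_one] at this
          rw [this, polyG2]
          simp
        rw [h1, ← ha]
        ext z
        have := pow_ne_zero s cG2_ne
        simp only [Pi.add_apply, Pi.smul_apply, Pi.mul_apply, Pi.pow_apply, Function.const_apply,
          smul_eq_mul, Pi.zero_apply]
        field_simp
        ring
      · rw [Polynomial.coeff_eq_zero_of_natDegree_lt (lt_of_le_of_lt hpow hlt),
          (Polynomial.degree_lt_iff_coeff_zero _ _).1 hp m hlt]
        simp)
    refine ⟨y + DirectSum.lof ℂ ℕ (fun i : ℕ => modTower (k - 2 * (i : ℤ))) s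
      ((cG2 ^ s)⁻¹ • a'), ?_⟩
    rw [map_add, Submodule.coe_add, hy]
    have : (expandMap k (DirectSum.lof ℂ ℕ (fun i : ℕ => modTower (k - 2 * (i : ℤ))) s
      ((cG2 ^ s)⁻¹ • a')) : ℍ → ℂ) = ((cG2 ^ s)⁻¹ • a) * eisG2 ^ s := by
      rw [expandMap, DirectSum.toModule_lof]; rfl
    rw [this, smul_mul_assoc, neg_smul, add_assoc, neg_add_cancel, add_zero]

lemma expandMap_bijective (k : ℤ) : Function.Bijective (expandMap k) := by
  refine ⟨expandMap_injective k, fun f => ?_⟩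
  obtain ⟨N, hN, p, hp⟩ := mem_quasiTower.1 f.2
  have : NeZero N := ⟨hN⟩
  obtain ⟨x, hx⟩ := mem_range_expandMap k N (p.natDegree + 1) p f hp (by
    by_cases h0 : p = 0
    · simp [h0]
    · rw [← Polynomial.natDegree_lt_iff_degree_lt h0]; omega)
  exact ⟨x, Subtype.ext hx⟩

/-- The expansion `f = ∑ a_i(f) G₂ ^ i` with modular coefficients `a_i(f)` of weight `k - 2 i`:
the inverse of this isomorphism sends `f` to `(a_i(f))`. -/
def expand (k : ℤ) : (⨁ i : ℕ, modTower (k - 2 * (i : ℤ))) ≃ₗ[ℂ] quasiTower k :=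
  LinearEquiv.ofBijective (expandMap k) (expandMap_bijective k)

lemma expand_lof (k : ℤ) (i : ℕ) (a : modTower (k - 2 * (i : ℤ))) :
    expand k (DirectSum.lof ℂ ℕ _ i a) = expandComp k i a := by
  rw [expand, LinearEquiv.ofBijective_apply, expandMap, DirectSum.toModule_lof]

/-! ### Operators on the modular tower -/

/-- The weight `w` slash action of `SL(2, ℤ)` on the modular tower. -/
def modSlash (w : ℤ) (γ : SL(2, ℤ)) : modTower w →ₗ[ℂ] modTower w where
  toFun f := ⟨(f : ℍ → ℂ) ∣[w] γ, modTower_slash f.2 γ⟩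
  map_add' f g := Subtype.ext (SlashAction.add_slash w γ (f : ℍ → ℂ) g)
  map_smul' c f := Subtype.ext (ModularForm.SL_smul_slash w γ (f : ℍ → ℂ) c)

/-- The discriminant `Δ = (2π)¹² q ∏ (1 - qⁿ)²⁴ = (2π)¹² η²⁴` on the upper half plane. -/
def Delta (z : ℍ) : ℂ := (2 * Real.pi) ^ 12 * ModularForm.discriminant z

/-- The Ramanujan differential operator in weight `w`:
`f ↦ (2πi)⁻¹ f' - (12πi)⁻¹ (log Δ)' (w / 2) f`. -/
def ramanujan (w : ℤ) (f : ℍ → ℂ) (z : ℍ) : ℂ :=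
  1 / (2 * Real.pi * Complex.I) * deriv (f ∘ UpperHalfPlane.ofComplex) z -
    1 / (12 * Real.pi * Complex.I) * logDeriv (Delta ∘ UpperHalfPlane.ofComplex) z *
      (((w : ℂ) / 2) * f z)

lemma logDeriv_Delta (z : ℍ) : logDeriv (Delta ∘ UpperHalfPlane.ofComplex) z =
    2 * Real.pi * Complex.I * EisensteinSeries.E2 z := by
  have hev : (Delta ∘ UpperHalfPlane.ofComplex) =ᶠ[nhds (z : ℂ)]
      fun w => ((2 * Real.pi) ^ 12 : ℂ) * ModularForm.eta w ^ 24 := by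
    filter_upwards [UpperHalfPlane.isOpen_upperHalfPlaneSet.mem_nhds z.im_pos] with w hw
    simp [Delta, ModularForm.discriminant, UpperHalfPlane.ofComplex_apply_of_im_pos hw]
  have hd := ModularForm.differentiableAt_eta_of_mem_upperHalfPlaneSet z.im_pos
  have hne := ModularForm.eta_ne_zero z.im_pos
  rw [logDeriv_apply, hev.deriv_eq, hev.eq_of_nhds, ← logDeriv_apply,
    logDeriv_const_mul _ _ (by simp [Real.pi_ne_zero]), logDeriv_fun_pow hd,
    ModularForm.logDeriv_eta_eq_E2]
  push_cast
  ring

lemma ramanujan_eq (w : ℤ) (f : ℍ → ℂ) : ramanujan w f = Derivative.serreDerivative w f := by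
  ext z
  rw [ramanujan, logDeriv_Delta, Derivative.serreDerivative_apply,
    Derivative.normalizedDerivOfComplex]
  have : (Real.pi : ℂ) ≠ 0 := by simp [Real.pi_ne_zero]
  field_simp

lemma isBoundedAtImInfty_deriv {f : ℍ → ℂ} (hf : MDiff f) (hb : IsBoundedAtImInfty f) :
    IsBoundedAtImInfty (Derivative.normalizedDerivOfComplex f) := by
  rw [UpperHalfPlane.isBoundedAtImInfty_iff] at hb ⊢
  obtain ⟨M, A, h⟩ := hb
  rw [UpperHalfPlane.mdifferentiable_iff] at hf
  refine ⟨‖(2 * Real.pi * Complex.I : ℂ)⁻¹‖ * (M / (1 / 2)), max A 0 + 1, fun z hz => ?_⟩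
  rw [Derivative.normalizedDerivOfComplex, norm_mul]
  refine mul_le_mul_of_nonneg_left ?_ (norm_nonneg _)
  have him : ∀ w ∈ Metric.closedBall (z : ℂ) (1 / 2), max A 0 < w.im := by
    intro w hw
    have h1 : |w.im - z.im| ≤ 1 / 2 := by
      have := Complex.abs_im_le_norm (w - z)
      rw [Complex.sub_im] at this
      exact this.trans (by simpa [dist_eq_norm] using hw)
    have := (abs_le.1 h1).1
    linarith
  apply Complex.norm_deriv_le_of_forall_mem_sphere_norm_le (by norm_num)
  · apply DifferentiableOn.diffContOnCl
    rw [closure_ball _ (by norm_num)]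
    exact hf.mono fun w hw => lt_of_le_of_lt (le_max_right A 0) (him w hw)
  · intro w hw
    have hw' := him w (Metric.sphere_subset_closedBall hw)
    have hpos : 0 < w.im := lt_of_le_of_lt (le_max_right A 0) hw'
    rw [Function.comp_apply, UpperHalfPlane.ofComplex_apply_of_im_pos hpos]
    exact h _ (le_trans (le_max_left A 0) hw'.le)

lemma ramanujan_slash {w : ℤ} {f : ℍ → ℂ} (hf : MDiff f) (γ : SL(2, ℤ)) :
    ramanujan w f ∣[w + 2] γ = ramanujan w (f ∣[w] γ) := by
  rw [ramanujan_eq, ramanujan_eq, Derivative.serreDerivative_slash_equivariant hf]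

lemma modTower_holo {w : ℤ} {f : ℍ → ℂ} (hf : f ∈ modTower w) : MDiff f := by
  obtain ⟨N, hN, hf⟩ := hf
  have : NeZero N := ⟨hN⟩
  exact (isModular_iff.1 hf).1.1

lemma modTower_ramanujan {w : ℤ} {f : ℍ → ℂ} (hf : f ∈ modTower w) :
    ramanujan w f ∈ modTower (w + 2) := by
  obtain ⟨N, hN, hf⟩ := hf
  have : NeZero N := ⟨hN⟩
  obtain ⟨⟨h1, h2⟩, h3⟩ := isModular_iff.1 hf
  refine ⟨N, hN, isModular_iff.2 ⟨⟨?_, fun δ => ?_⟩, fun γ hγ => ?_⟩⟩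
  · rw [ramanujan_eq]; exact Derivative.serreDerivative_mdifferentiable _ h1
  · rw [ramanujan_slash h1, ramanujan_eq]
    have hb := isBoundedAtImInfty_deriv (h1.slash w (δ : GL (Fin 2) ℝ)) (h2 δ)
    have hE := (EisensteinSeries.isBoundedAtImInfty_E2.mul (h2 δ)).const_smul_left
      ((w : ℂ) * 12⁻¹)
    have := Filter.BoundedAtFilter.add hb (Filter.BoundedAtFilter.neg hE)
    refine this.congr_left fun z => ?_
    simp only [Pi.add_apply, Pi.neg_apply, Pi.smul_apply, Pi.mul_apply, smul_eq_mul,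
      Derivative.serreDerivative_apply]
    change Derivative.normalizedDerivOfComplex (f ∣[w] δ) z + _ = _
    ring
  · rw [ramanujan_slash h1, h3 γ hγ]

/-- The Ramanujan operator `X` on the weight `w` part of the modular tower, with values in weight
`w' = w + 2`. -/
def modX (w w' : ℤ) (h : w' = w + 2) : modTower w →ₗ[ℂ] modTower w' where
  toFun f := ⟨ramanujan w (f : ℍ → ℂ), h ▸ modTower_ramanujan f.2⟩
  map_add' f g := Subtype.ext (by
    simp only [ramanujan_eq, Submodule.coe_add]
    exact Derivative.serreDerivative_add _ _ _ (modTower_holo f.2) (modTower_holo g.2))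
  map_smul' c f := Subtype.ext (by
    simp only [ramanujan_eq, Submodule.coe_smul, RingHom.id_apply]
    exact Derivative.serreDerivative_smul _ _ _ (modTower_holo f.2))

/-- The operator `Y` on the weight `w` part of the modular tower: multiplication by `w / 2`. -/
def modY (w : ℤ) : modTower w →ₗ[ℂ] modTower w := ((w : ℂ) / 2) • LinearMap.id

/-! ### The quasimodular tower and its operators -/

/-- The part of weight `k ≥ 0` of the quasimodular tower. -/
abbrev quasiGr (k : ℕ) : Submodule ℂ (ℍ → ℂ) := quasiTower (k : ℤ)

instance quasiGr_gradedMonoid : SetLike.GradedMonoid quasiGr where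
  one_mem := by
    refine modTower_le_quasiTower _ ⟨1, one_ne_zero, isModular_iff.2 ⟨?_, fun γ _ => ?_⟩⟩
    · simpa using HoloBdd.one
    · simpa using ModularForm.is_invariant_one γ
  mul_mem := by
    intro k l f g hf hg
    have := quasiTower_mul hf hg
    exact this

/-- The quasimodular tower, a commutative `ℂ`-algebra graded by the weight. -/
abbrev QM : Type := ⨁ k : ℕ, quasiGr k

/-- `f ↦ f || γ` in weight `k`: the slash action applied to the modular coefficients `a_i(f)`. -/
def quasiSlash (γ : SL(2, ℤ)) (k : ℕ) : quasiGr k →ₗ[ℂ] quasiGr k :=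
  (expand k).toLinearMap ∘ₗ
    DirectSum.lmap (fun i : ℕ => modSlash ((k : ℤ) - 2 * (i : ℤ)) γ) ∘ₗ
      (expand k).symm.toLinearMap

/-- `X` in weight `k`: the Ramanujan operator applied to the modular coefficients `a_i(f)`. -/
def quasiX (k : ℕ) : quasiGr k →ₗ[ℂ] quasiGr (k + 2) :=
  (expand ((k + 2 : ℕ) : ℤ)).toLinearMap ∘ₗ
    DirectSum.lmap (fun i : ℕ => modX ((k : ℤ) - 2 * (i : ℤ)) (((k + 2 : ℕ) : ℤ) - 2 * (i : ℤ))
      (by push_cast; ring)) ∘ₗ (expand k).symm.toLinearMap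

/-- `Y` in weight `k`: the weight operator applied to the modular coefficients `a_i(f)`. -/
def quasiY (k : ℕ) : quasiGr k →ₗ[ℂ] quasiGr k :=
  (expand k).toLinearMap ∘ₗ
    DirectSum.lmap (fun i : ℕ => modY ((k : ℤ) - 2 * (i : ℤ))) ∘ₗ (expand k).symm.toLinearMap

/-- The operation `f ↦ f || γ` on the quasimodular tower. -/
def slashQM (γ : SL(2, ℤ)) : QM →ₗ[ℂ] QM := DirectSum.lmap (quasiSlash γ)

/-- The operator `X` on the quasimodular tower. -/
def XQM : QM →ₗ[ℂ] QM :=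
  DirectSum.toModule ℂ ℕ QM fun k => DirectSum.lof ℂ ℕ (fun k => quasiGr k) (k + 2) ∘ₗ quasiX k

/-- The operator `Y` on the quasimodular tower. -/
def YQM : QM →ₗ[ℂ] QM := DirectSum.lmap quasiY

/-- The element `a G₂ ^ i` of weight `k` of the quasimodular tower. -/
def gen (k i : ℕ) (a : modTower ((k : ℤ) - 2 * (i : ℤ))) : QM :=
  DirectSum.lof ℂ ℕ (fun k => quasiGr k) k (expandComp k i a)

lemma QM_hom_ext {M : Type*} [AddCommMonoid M] [Module ℂ M] {f g : QM →ₗ[ℂ] M}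
    (h : ∀ k i a, f (gen k i a) = g (gen k i a)) : f = g := by
  apply DirectSum.linearMap_ext
  intro k
  have : (f ∘ₗ DirectSum.lof ℂ ℕ (fun k => quasiGr k) k) ∘ₗ (expand k).toLinearMap =
      (g ∘ₗ DirectSum.lof ℂ ℕ (fun k => quasiGr k) k) ∘ₗ (expand k).toLinearMap := by
    apply DirectSum.linearMap_ext
    intro i
    ext a
    simp only [LinearMap.comp_apply, LinearEquiv.coe_coe, expand_lof]
    exact h k i a
  ext x
  have h2 := LinearMap.congr_fun this ((expand k).symm x)
  simpa using h2

lemma slashQM_gen (γ : SL(2, ℤ)) (k i : ℕ) (a : modTower ((k : ℤ) - 2 * (i : ℤ))) :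
    slashQM γ (gen k i a) = gen k i (modSlash _ γ a) := by
  rw [slashQM, gen, DirectSum.lmap_lof, gen]
  congr 1
  rw [← expand_lof, quasiSlash, LinearMap.comp_apply, LinearMap.comp_apply, LinearEquiv.coe_coe,
    LinearEquiv.coe_coe, LinearEquiv.symm_apply_apply, DirectSum.lmap_lof, expand_lof]

lemma XQM_gen (k i : ℕ) (a : modTower ((k : ℤ) - 2 * (i : ℤ))) :
    XQM (gen k i a) = gen (k + 2) i (modX _ _ (by push_cast; ring) a) := by
  rw [XQM, gen, DirectSum.toModule_lof, gen, LinearMap.comp_apply]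
  congr 1
  rw [← expand_lof, quasiX, LinearMap.comp_apply, LinearMap.comp_apply, LinearEquiv.coe_coe,
    LinearEquiv.coe_coe, LinearEquiv.symm_apply_apply, DirectSum.lmap_lof, expand_lof]

lemma YQM_gen (k i : ℕ) (a : modTower ((k : ℤ) - 2 * (i : ℤ))) :
    YQM (gen k i a) = gen k i (modY _ a) := by
  rw [YQM, gen, DirectSum.lmap_lof, gen]
  congr 1
  rw [← expand_lof, quasiY, LinearMap.comp_apply, LinearMap.comp_apply, LinearEquiv.coe_coe,
    LinearEquiv.coe_coe, LinearEquiv.symm_apply_apply, DirectSum.lmap_lof, expand_lof]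

lemma gen_mul (k l i j : ℕ) (a : modTower ((k : ℤ) - 2 * (i : ℤ)))
    (b : modTower ((l : ℤ) - 2 * (j : ℤ)))
    (c : modTower (((k + l : ℕ) : ℤ) - 2 * ((i + j : ℕ) : ℤ)))
    (hc : (c : ℍ → ℂ) = (a : ℍ → ℂ) * b) : gen k i a * gen l j b = gen (k + l) (i + j) c := by
  simp only [gen, DirectSum.lof_eq_of]
  rw [DirectSum.of_mul_of]
  congr 1
  apply Subtype.ext
  change ((a : ℍ → ℂ) * eisG2 ^ i) * ((b : ℍ → ℂ) * eisG2 ^ j) = (c : ℍ → ℂ) * eisG2 ^ (i + j)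
  rw [hc, pow_add]; ring

lemma slashQM_one (f : QM) : slashQM 1 f = f := by
  have : slashQM 1 = LinearMap.id := QM_hom_ext fun k i a => by
    rw [slashQM_gen]
    congr 1
    exact Subtype.ext (SlashAction.slash_one _ _)
  rw [this]; rfl

lemma slashQM_slashQM (γ δ : SL(2, ℤ)) (f : QM) :
    slashQM δ (slashQM γ f) = slashQM (γ * δ) f := by
  have : slashQM δ ∘ₗ slashQM γ = slashQM (γ * δ) := QM_hom_ext fun k i a => by
    rw [LinearMap.comp_apply, slashQM_gen, slashQM_gen, slashQM_gen]
    congr 1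
    exact Subtype.ext (SlashAction.slash_mul _ _ _ _).symm
  exact LinearMap.congr_fun this f

lemma slashQM_XQM (γ : SL(2, ℤ)) (f : QM) : slashQM γ (XQM f) = XQM (slashQM γ f) := by
  have : slashQM γ ∘ₗ XQM = XQM ∘ₗ slashQM γ := QM_hom_ext fun k i a => by
    rw [LinearMap.comp_apply, LinearMap.comp_apply, slashQM_gen, XQM_gen, XQM_gen, slashQM_gen]
    congr 1
    apply Subtype.ext
    change ramanujan _ (a : ℍ → ℂ) ∣[_] γ = ramanujan _ ((a : ℍ → ℂ) ∣[_] γ)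
    rw [← ramanujan_slash (modTower_holo a.2)]
    congr 1; push_cast; ring
  exact LinearMap.congr_fun this f

lemma slashQM_YQM (γ : SL(2, ℤ)) (f : QM) : slashQM γ (YQM f) = YQM (slashQM γ f) := by
  have : slashQM γ ∘ₗ YQM = YQM ∘ₗ slashQM γ := QM_hom_ext fun k i a => by
    rw [LinearMap.comp_apply, LinearMap.comp_apply, slashQM_gen, YQM_gen, YQM_gen, slashQM_gen]
    congr 1
    simp [modY]
  exact LinearMap.congr_fun this f

lemma QM_induction {p : QM → Prop} (h0 : p 0) (hadd : ∀ f g, p f → p g → p (f + g))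
    (hgen : ∀ k i a, p (gen k i a)) (f : QM) : p f := by
  induction f using DirectSum.induction_on with
  | zero => exact h0
  | add f g hf hg => exact hadd f g hf hg
  | of k x =>
    obtain ⟨y, rfl⟩ := (expand (k : ℤ)).surjective x
    induction y using DirectSum.induction_on with
    | zero => simpa using h0
    | add f g hf hg => rw [map_add, map_add]; exact hadd _ _ hf hg
    | of i a =>
      have := hgen k i a
      rw [gen, ← expand_lof] at this
      exact this

lemma slashQM_mul (γ : SL(2, ℤ)) (f g : QM) :
    slashQM γ (f * g) = slashQM γ f * slashQM γ g := by
  induction f using QM_induction with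
  | h0 => simp
  | hadd f f' hf hf' => simp [add_mul, hf, hf']
  | hgen k i a =>
    induction g using QM_induction with
    | h0 => simp
    | hadd f f' hf hf' => simp [mul_add, hf, hf']
    | hgen l j b =>
      have hw : ((k : ℤ) - 2 * (i : ℤ)) + ((l : ℤ) - 2 * (j : ℤ)) =
        ((k + l : ℕ) : ℤ) - 2 * ((i + j : ℕ) : ℤ) := by push_cast; ring
      have hm : (a : ℍ → ℂ) * b ∈ modTower (((k + l : ℕ) : ℤ) - 2 * ((i + j : ℕ) : ℤ)) :=
        hw ▸ modTower_mul a.2 b.2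
      rw [gen_mul k l i j a b ⟨_, hm⟩ rfl, slashQM_gen, slashQM_gen, slashQM_gen]
      symm
      apply gen_mul
      have := ModularForm.mul_slash_SL2 ((k : ℤ) - 2 * (i : ℤ)) ((l : ℤ) - 2 * (j : ℤ)) γ a b
      rw [hw] at this
      exact this

/-! ### Twisted quasimodular Hecke operators -/

/-- The inclusion of `SL(2, ℤ)` in `GL(2, ℚ)⁺`. -/
def slGL : SL(2, ℤ) →* GL(2, ℚ)⁺ :=
  Matrix.SpecialLinearGroup.toGLPos.comp
    (Matrix.SpecialLinearGroup.map (Int.castRingHom ℚ))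

/-- `Γ(N)` as a subgroup of `GL(2, ℚ)⁺`. -/
def GammaGL (N : ℕ) : Subgroup GL(2, ℚ)⁺ := (CongruenceSubgroup.Gamma N).map slGL

/-- The set of left cosets `Γ(N)\GL(2, ℚ)⁺` (cosets of the form `Γ(N) α`). -/
abbrev CosetGL (N : ℕ) : Type := Quotient (QuotientGroup.rightRel (GammaGL N))

/-- The set of left cosets `Γ(N)\SL(2, ℤ)` (cosets of the form `Γ(N) β`). -/
abbrev CosetSL (N : ℕ) : Type := Quotient (QuotientGroup.rightRel (CongruenceSubgroup.Gamma N))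

lemma mk_mul_left {N : ℕ} {γ : SL(2, ℤ)} (hγ : γ ∈ CongruenceSubgroup.Gamma N) (α : GL(2, ℚ)⁺) :
    (Quotient.mk _ (slGL γ * α) : CosetGL N) = Quotient.mk _ α := by
  apply Quotient.sound
  rw [← Quotient.eq_iff_equiv, Quotient.eq, QuotientGroup.rightRel_apply]
  refine ⟨γ⁻¹, inv_mem hγ, ?_⟩
  rw [map_inv]; group

/-- The space `𝒬_σ(Γ(N))` of `σ`-twisted quasimodular Hecke operators of level `Γ(N)`: functions
of finite support on `Γ(N)\GL(2, ℚ)⁺` with values in the quasimodular tower, regarded as left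
`Γ(N)`-invariant functions on `GL(2, ℚ)⁺`, such that `F_{αγ} = F_α || σγσ⁻¹` for `γ ∈ Γ(N)`. -/
def twistedHecke (N : ℕ) (σ : SL(2, ℤ)) : Submodule ℂ (GL(2, ℚ)⁺ → QM) where
  carrier := {F |
    (∀ γ ∈ CongruenceSubgroup.Gamma N, ∀ α, F (slGL γ * α) = F α) ∧
    ((fun α => (Quotient.mk _ α : CosetGL N)) '' Function.support F).Finite ∧
    ∀ γ ∈ CongruenceSubgroup.Gamma N, ∀ α, F (α * slGL γ) = slashQM (σ * γ * σ⁻¹) (F α)}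
  zero_mem' := ⟨fun _ _ _ => rfl, by simp, fun γ _ α => by simp⟩
  add_mem' := by
    rintro F G ⟨h1, h2, h3⟩ ⟨k1, k2, k3⟩
    refine ⟨fun γ hγ α => ?_, ?_, fun γ hγ α => ?_⟩
    · simp only [Pi.add_apply, h1 γ hγ, k1 γ hγ]
    · refine (h2.union k2).subset ?_
      rw [← Set.image_union]
      exact Set.image_mono (Function.support_add F G)
    · simp only [Pi.add_apply, h3 γ hγ, k3 γ hγ, map_add]
  smul_mem' := by
    rintro c F ⟨h1, h2, h3⟩
    refine ⟨fun γ hγ α => ?_, ?_, fun γ hγ α => ?_⟩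
    · simp only [Pi.smul_apply, h1 γ hγ]
    · exact h2.subset (Set.image_mono (Function.support_const_smul_subset c F))
    · simp only [Pi.smul_apply, h3 γ hγ, map_smul]

/-- A linear map of `QM` into itself that intertwines the operations `|| γ` induces a map between
spaces of twisted Hecke operators. -/
lemma twistedHecke_map {N : ℕ} {σ σ' : SL(2, ℤ)} (L : QM →ₗ[ℂ] QM)
    (hL : ∀ (γ : SL(2, ℤ)) (f : QM), L (slashQM (σ * γ * σ⁻¹) f) =
      slashQM (σ' * γ * σ'⁻¹) (L f))
    {F : GL(2, ℚ)⁺ → QM} (hF : F ∈ twistedHecke N σ) :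
    (fun α => L (F α)) ∈ twistedHecke N σ' := by
  obtain ⟨h1, h2, h3⟩ := hF
  refine ⟨fun γ hγ α => ?_, ?_, fun γ hγ α => ?_⟩
  · simp only [h1 γ hγ]
  · refine h2.subset (Set.image_mono fun α hα => ?_)
    rw [Function.mem_support] at hα ⊢
    intro h
    rw [h, map_zero] at hα
    exact hα rfl
  · simp only [h3 γ hγ, hL]

/-- The operator `X_τ : 𝒬_σ(Γ(N)) → 𝒬_{τσ}(Γ(N))`, `X_τ(F)_α = X(F_α) || τ⁻¹`. -/
def Xtau (N : ℕ) (σ τ σ' : SL(2, ℤ)) (h : σ' = τ * σ) :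
    twistedHecke N σ →ₗ[ℂ] twistedHecke N σ' where
  toFun F := ⟨fun α => slashQM τ⁻¹ (XQM ((F : GL(2, ℚ)⁺ → QM) α)),
    twistedHecke_map (slashQM τ⁻¹ ∘ₗ XQM) (fun γ f => by
      have e : σ * γ * σ⁻¹ * τ⁻¹ = τ⁻¹ * (σ' * γ * σ'⁻¹) := by rw [h]; group
      rw [LinearMap.comp_apply, LinearMap.comp_apply, ← slashQM_XQM, slashQM_slashQM,
        slashQM_slashQM, e]) F.2⟩
  map_add' F G := Subtype.ext (funext fun α => by
    change slashQM τ⁻¹ (XQM ((F : GL(2, ℚ)⁺ → QM) α + (G : GL(2, ℚ)⁺ → QM) α)) = _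
    rw [map_add, map_add]; rfl)
  map_smul' c F := Subtype.ext (funext fun α => by
    change slashQM τ⁻¹ (XQM (c • (F : GL(2, ℚ)⁺ → QM) α)) = _
    rw [map_smul, map_smul]; rfl)

/-- The operator `Y` on `𝒬_σ(Γ(N))`, `Y(F)_α = Y(F_α)`. -/
def Yhecke (N : ℕ) (σ : SL(2, ℤ)) : twistedHecke N σ →ₗ[ℂ] twistedHecke N σ where
  toFun F := ⟨fun α => YQM ((F : GL(2, ℚ)⁺ → QM) α),
    twistedHecke_map YQM (fun γ f => (slashQM_YQM _ f).symm) F.2⟩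
  map_add' F G := Subtype.ext (funext fun α => by simp)
  map_smul' c F := Subtype.ext (funext fun α => by simp)

/-! ### The pairing -/

lemma QM_smul_mul (c : ℂ) (f g : QM) : (c • f) * g = c • (f * g) := by
  induction f using DirectSum.induction_on with
  | zero => simp
  | add f f' hf hf' => rw [smul_add, add_mul, hf, hf', add_mul, smul_add]
  | of k x =>
    induction g using DirectSum.induction_on with
    | zero => simp
    | add f f' hf hf' => rw [mul_add, hf, hf', mul_add, smul_add]
    | of l y =>
      rw [← DirectSum.lof_eq_of ℂ, ← map_smul, DirectSum.lof_eq_of, DirectSum.lof_eq_of,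
        DirectSum.of_mul_of, DirectSum.of_mul_of, ← DirectSum.lof_eq_of ℂ, ← DirectSum.lof_eq_of ℂ,
        ← map_smul]
      congr 1
      exact Subtype.ext (smul_mul_assoc c (x : ℍ → ℂ) (y : ℍ → ℂ))

/-- The summand `(F¹_{βσ} || τ₂⁻¹) · (F²_{ασ⁻¹β⁻¹} || τ₂σβτ₁⁻¹τ₂⁻¹)` of the pairing. -/
def pairTerm (σ τ₁ τ₂ : SL(2, ℤ)) (F₁ F₂ : GL(2, ℚ)⁺ → QM) (α : GL(2, ℚ)⁺) (β : SL(2, ℤ)) : QM :=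
  slashQM τ₂⁻¹ (F₁ (slGL (β * σ))) *
    slashQM (τ₂ * σ * β * τ₁⁻¹ * τ₂⁻¹) (F₂ (α * slGL (σ⁻¹ * β⁻¹)))

lemma pairTerm_mul_left {N : ℕ} {σ τ₁ τ₂ : SL(2, ℤ)} {F₁ F₂ : GL(2, ℚ)⁺ → QM}
    (h₁ : F₁ ∈ twistedHecke N (τ₁ * σ)) (h₂ : F₂ ∈ twistedHecke N (τ₂ * σ)) (α : GL(2, ℚ)⁺)
    {γ : SL(2, ℤ)} (hγ : γ ∈ CongruenceSubgroup.Gamma N) (β : SL(2, ℤ)) :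
    pairTerm σ τ₁ τ₂ F₁ F₂ α (γ * β) = pairTerm σ τ₁ τ₂ F₁ F₂ α β := by
  have e1 : F₁ (slGL (γ * β * σ)) = F₁ (slGL (β * σ)) := by
    rw [mul_assoc, map_mul]; exact h₁.1 γ hγ _
  have e2 : F₂ (α * slGL (σ⁻¹ * (γ * β)⁻¹)) =
      slashQM (τ₂ * σ * γ⁻¹ * (τ₂ * σ)⁻¹) (F₂ (α * slGL (σ⁻¹ * β⁻¹))) := by
    rw [← h₂.2.2 γ⁻¹ (inv_mem hγ), mul_assoc, ← map_mul]
    congr 3; group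
  rw [pairTerm, pairTerm, e1, e2, slashQM_slashQM]
  congr 3; group

lemma pairTerm_eq_of_mk_eq {N : ℕ} {σ τ₁ τ₂ : SL(2, ℤ)} {F₁ F₂ : GL(2, ℚ)⁺ → QM}
    (h₁ : F₁ ∈ twistedHecke N (τ₁ * σ)) (h₂ : F₂ ∈ twistedHecke N (τ₂ * σ)) (α : GL(2, ℚ)⁺)
    {β β' : SL(2, ℤ)} (h : QuotientGroup.rightRel (CongruenceSubgroup.Gamma N) β β') :
    pairTerm σ τ₁ τ₂ F₁ F₂ α β = pairTerm σ τ₁ τ₂ F₁ F₂ α β' := by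
  rw [QuotientGroup.rightRel_apply] at h
  have := pairTerm_mul_left h₁ h₂ α h β
  rw [← this]; congr 1; group

instance finite_cosetSL (N : ℕ) [NeZero N] : Finite (CosetSL N) := by
  have : Finite (SL(2, ℤ) ⧸ CongruenceSubgroup.Gamma N) := inferInstance
  exact Finite.of_equiv _ (QuotientGroup.quotientRightRelEquivQuotientLeftRel _).symm

noncomputable instance fintype_cosetSL (N : ℕ) [NeZero N] : Fintype (CosetSL N) :=
  Fintype.ofFinite _

/-- The pairing of `F₁ ∈ 𝒬_{τ₁σ}(Γ(N))` and `F₂ ∈ 𝒬_{τ₂σ}(Γ(N))`, as a function on `GL(2, ℚ)⁺`: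
the sum of `pairTerm` over `β ∈ Γ(N)\SL(2, ℤ)`. -/
def pairFun (N : ℕ) [NeZero N] (σ τ₁ τ₂ : SL(2, ℤ)) (F₁ : twistedHecke N (τ₁ * σ))
    (F₂ : twistedHecke N (τ₂ * σ)) (α : GL(2, ℚ)⁺) : QM :=
  ∑ q : CosetSL N, Quotient.lift (pairTerm σ τ₁ τ₂ F₁ F₂ α)
    (fun _ _ h => pairTerm_eq_of_mk_eq F₁.2 F₂.2 α h) q

/-- Right translation by `δ`, which normalizes `Γ(N)`, on `Γ(N)\SL(2, ℤ)`. -/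
def cosetShift (N : ℕ) (δ : SL(2, ℤ)) : CosetSL N ≃ CosetSL N where
  toFun := Quotient.map (· * δ) fun a b h => by
    rw [← Quotient.eq_iff_equiv, Quotient.eq, QuotientGroup.rightRel_apply] at h ⊢
    convert h using 1; group
  invFun := Quotient.map (· * δ⁻¹) fun a b h => by
    rw [← Quotient.eq_iff_equiv, Quotient.eq, QuotientGroup.rightRel_apply] at h ⊢
    convert h using 1; group
  left_inv := by
    rintro ⟨a⟩
    change Quotient.mk _ (a * δ * δ⁻¹) = Quotient.mk _ a
    rw [mul_inv_cancel_right]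
  right_inv := by
    rintro ⟨a⟩
    change Quotient.mk _ (a * δ⁻¹ * δ) = Quotient.mk _ a
    rw [inv_mul_cancel_right]

lemma pairFun_mem {N : ℕ} [NeZero N] {σ τ₁ τ₂ : SL(2, ℤ)} (hτ : τ₁ * τ₂ = τ₂ * τ₁)
    (F₁ : twistedHecke N (τ₁ * σ)) (F₂ : twistedHecke N (τ₂ * σ)) :
    pairFun N σ τ₁ τ₂ F₁ F₂ ∈ twistedHecke N (τ₁ * τ₂ * σ) := by
  refine ⟨fun γ hγ α => ?_, ?_, fun γ hγ α => ?_⟩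
  · refine Finset.sum_congr rfl fun q _ => ?_
    induction q using Quotient.inductionOn with
    | h β =>
      simp only [Quotient.lift_mk, pairTerm]
      rw [mul_assoc (slGL γ) α, F₂.2.1 γ hγ]
  · have hfin : (⋃ q : CosetSL N, (fun x : CosetGL N =>
        (Quotient.mk _ (x.out * slGL (q.out * σ)) : CosetGL N)) ''
          ((fun α => (Quotient.mk _ α : CosetGL N)) ''
            Function.support (F₂ : GL(2, ℚ)⁺ → QM))).Finite :=
      Set.finite_iUnion fun q => F₂.2.2.1.image _
    refine hfin.subset ?_
    rintro _ ⟨α, hα, rfl⟩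
    obtain ⟨q, -, hq⟩ := Finset.exists_ne_zero_of_sum_ne_zero hα
    rw [← q.out_eq, Quotient.lift_mk, pairTerm] at hq
    have hne : (F₂ : GL(2, ℚ)⁺ → QM) (α * slGL (σ⁻¹ * q.out⁻¹)) ≠ 0 := by
      intro h
      rw [h, map_zero, mul_zero] at hq
      exact hq rfl
    refine Set.mem_iUnion.2 ⟨q, _, ⟨_, hne, rfl⟩, ?_⟩
    have hx := Quotient.mk_out (s := QuotientGroup.rightRel (GammaGL N))
      (α * slGL (σ⁻¹ * q.out⁻¹))
    rw [QuotientGroup.rightRel_apply] at hx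
    apply Quotient.sound
    rw [← Quotient.eq_iff_equiv, Quotient.eq, QuotientGroup.rightRel_apply]
    convert hx using 1
    simp only [map_mul, map_inv]
    group
  · rw [pairFun, ← Equiv.sum_comp (cosetShift N (σ * γ * σ⁻¹)), pairFun, map_sum]
    refine Finset.sum_congr rfl fun q _ => ?_
    induction q using Quotient.inductionOn with
    | h β =>
      change pairTerm σ τ₁ τ₂ F₁ F₂ (α * slGL γ) (β * (σ * γ * σ⁻¹)) =
        slashQM _ (pairTerm σ τ₁ τ₂ F₁ F₂ α β)
      have e1 : (F₁ : GL(2, ℚ)⁺ → QM) (slGL (β * (σ * γ * σ⁻¹) * σ)) =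
          slashQM (τ₁ * σ * γ * (τ₁ * σ)⁻¹) ((F₁ : GL(2, ℚ)⁺ → QM) (slGL (β * σ))) := by
        rw [← F₁.2.2.2 γ hγ, ← map_mul]
        group
      have e2 : α * slGL γ * slGL (σ⁻¹ * (β * (σ * γ * σ⁻¹))⁻¹) = α * slGL (σ⁻¹ * β⁻¹) := by
        rw [mul_assoc, ← map_mul]
        congr 2; group
      have hτ' : τ₂⁻¹ * τ₁ = τ₁ * τ₂⁻¹ := by
        rw [inv_mul_eq_iff_eq_mul, ← mul_assoc, ← hτ, mul_inv_cancel_right]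
      rw [pairTerm, pairTerm, slashQM_mul, e1, e2]
      simp only [slashQM_slashQM]
      congr 3
      · rw [show τ₂⁻¹ * (τ₁ * τ₂ * σ * γ * (τ₁ * τ₂ * σ)⁻¹) =
          (τ₂⁻¹ * τ₁) * τ₂ * σ * γ * (τ₁ * τ₂ * σ)⁻¹ by group, hτ',
          hτ]
        group
      · rw [hτ]
        group

/-- The pairing `𝒬_{τ₁σ}(Γ(N)) ⊗ 𝒬_{τ₂σ}(Γ(N)) → 𝒬_{τ₁τ₂σ}(Γ(N))` for commuting `τ₁`, `τ₂`. -/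
def pairMap (N : ℕ) [NeZero N] (σ τ₁ τ₂ σ' : SL(2, ℤ)) (hτ : τ₁ * τ₂ = τ₂ * τ₁)
    (h : σ' = τ₁ * τ₂ * σ) :
    twistedHecke N (τ₁ * σ) →ₗ[ℂ] twistedHecke N (τ₂ * σ) →ₗ[ℂ] twistedHecke N σ' :=
  LinearMap.mk₂ ℂ (fun F₁ F₂ => ⟨pairFun N σ τ₁ τ₂ F₁ F₂, h ▸ pairFun_mem hτ F₁ F₂⟩)
    (fun F F' G => Subtype.ext <| funext fun α => by
      simp only [pairFun, Submodule.coe_add, Pi.add_apply, ← Finset.sum_add_distrib]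
      refine Finset.sum_congr rfl fun q _ => ?_
      induction q using Quotient.inductionOn with
      | h β => simp only [Quotient.lift_mk, pairTerm, Pi.add_apply, map_add, add_mul])
    (fun c F G => Subtype.ext <| funext fun α => by
      simp only [pairFun, Submodule.coe_smul, Pi.smul_apply, Finset.smul_sum]
      refine Finset.sum_congr rfl fun q _ => ?_
      induction q using Quotient.inductionOn with
      | h β => simp only [Quotient.lift_mk, pairTerm, Pi.smul_apply, map_smul, QM_smul_mul])
    (fun F G G' => Subtype.ext <| funext fun α => by
      simp only [pairFun, Submodule.coe_add, Pi.add_apply, ← Finset.sum_add_distrib]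
      refine Finset.sum_congr rfl fun q _ => ?_
      induction q using Quotient.inductionOn with
      | h β => simp only [Quotient.lift_mk, pairTerm, Pi.add_apply, map_add, mul_add])
    (fun c F G => Subtype.ext <| funext fun α => by
      simp only [pairFun, Submodule.coe_smul, Pi.smul_apply, Finset.smul_sum]
      refine Finset.sum_congr rfl fun q _ => ?_
      induction q using Quotient.inductionOn with
      | h β =>
        simp only [Quotient.lift_mk, pairTerm, Pi.smul_apply, map_smul]
        rw [mul_comm, QM_smul_mul, mul_comm])

/-! ### The graded module, its operators and its pairing -/

/-- The matrix `ρ_n = (1, n; 0, 1)`. -/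
def rho (n : ℤ) : SL(2, ℤ) := ⟨!![1, n; 0, 1], by simp⟩

lemma rho_add (m n : ℤ) : rho (m + n) = rho m * rho n := by
  apply Subtype.ext
  rw [Matrix.SpecialLinearGroup.coe_mul]
  simp [rho, add_comm]

lemma rho_comm (m n : ℤ) : rho m * rho n = rho n * rho m := by
  rw [← rho_add, ← rho_add, add_comm]

/-- The degree `m` part `𝒬_{σ(m)}(Γ(N))`, `σ(m) = ρ_m σ`, of the graded module. -/
abbrev heckeGr (N : ℕ) (σ : SL(2, ℤ)) (m : ℤ) : Submodule ℂ (GL(2, ℚ)⁺ → QM) :=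
  twistedHecke N (rho m * σ)

/-- The graded module `ℚ_σ(Γ(N)) = ⨁_m 𝒬_{σ(m)}(Γ(N))`. -/
abbrev QQ (N : ℕ) (σ : SL(2, ℤ)) : Type := ⨁ m : ℤ, heckeGr N σ m

/-- The operator `X_n` of degree `n` on `ℚ_σ(Γ(N))`, given by
`X_{ρ_n} : 𝒬_{σ(m)}(Γ(N)) → 𝒬_{σ(m + n)}(Γ(N))`. -/
def Xop (N : ℕ) (σ : SL(2, ℤ)) (n : ℤ) : QQ N σ →ₗ[ℂ] QQ N σ :=
  DirectSum.toModule ℂ ℤ (QQ N σ) fun m =>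
    DirectSum.lof ℂ ℤ (fun m => heckeGr N σ m) (m + n) ∘ₗ
      Xtau N (rho m * σ) (rho n) (rho (m + n) * σ) (by
        rw [add_comm, rho_add, mul_assoc])

/-- The operator `Z` of degree `0` on `ℚ_σ(Γ(N))`: `Z(F)_α = m F_α + Y(F_α)` in degree `m`. -/
def Zop (N : ℕ) (σ : SL(2, ℤ)) : QQ N σ →ₗ[ℂ] QQ N σ :=
  DirectSum.lmap fun m : ℤ => (m : ℂ) • LinearMap.id + Yhecke N (rho m * σ)

/-- The pairing on `ℚ_σ(Γ(N))`, given by the pairings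
`𝒬_{σ(m)}(Γ(N)) ⊗ 𝒬_{σ(n)}(Γ(N)) → 𝒬_{σ(m + n)}(Γ(N))`. -/
def pairing (N : ℕ) [NeZero N] (σ : SL(2, ℤ)) : QQ N σ →ₗ[ℂ] QQ N σ →ₗ[ℂ] QQ N σ :=
  DirectSum.toModule ℂ ℤ (QQ N σ →ₗ[ℂ] QQ N σ) fun m => LinearMap.flip <|
    DirectSum.toModule ℂ ℤ (heckeGr N σ m →ₗ[ℂ] QQ N σ) fun n => LinearMap.flip <|
      (pairMap N σ (rho m) (rho n) (rho (m + n) * σ) (rho_comm m n)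
        (by rw [rho_add])).compr₂ (DirectSum.lof ℂ ℤ (fun m => heckeGr N σ m) (m + n))

/-- On homogeneous elements the pairing is given by `pairFun`. -/
lemma pairing_lof {N : ℕ} [NeZero N] {σ : SL(2, ℤ)} (m n : ℤ) (F : heckeGr N σ m)
    (G : heckeGr N σ n) :
    pairing N σ (DirectSum.lof ℂ ℤ (fun m => heckeGr N σ m) m F)
        (DirectSum.lof ℂ ℤ (fun m => heckeGr N σ m) n G) =
      DirectSum.lof ℂ ℤ (fun m => heckeGr N σ m) (m + n)
        (pairMap N σ (rho m) (rho n) (rho (m + n) * σ) (rho_comm m n) (by rw [rho_add]) F G) := by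
  simp [pairing]


/-! ### The Hopf algebra structure of an enveloping algebra -/

section Enveloping

attribute [local instance] LieRing.ofAssociativeRing

variable (R L : Type*) [CommRing R] [LieRing L] [LieAlgebra R L]

/-- Short name for the enveloping algebra. -/
abbrev Env : Type _ := UniversalEnvelopingAlgebra R L

/-- The coproduct of the enveloping algebra, `Δ(x) = x ⊗ 1 + 1 ⊗ x` for `x` in the Lie algebra. -/
def envComul : Env R L →ₐ[R] Env R L ⊗[R] Env R L :=
  UniversalEnvelopingAlgebra.lift R
    { toFun := fun x => UniversalEnvelopingAlgebra.ι R x ⊗ₜ[R] (1 : Env R L) +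
        (1 : Env R L) ⊗ₜ[R] UniversalEnvelopingAlgebra.ι R x
      map_add' := fun x y => by
        rw [map_add, TensorProduct.add_tmul, TensorProduct.tmul_add]; abel
      map_smul' := fun c x => by
        rw [map_smul, ← TensorProduct.smul_tmul', TensorProduct.tmul_smul, smul_add,
          RingHom.id_apply]
      map_lie' := fun {x y} => by
        simp only [LieHom.map_lie, LieRing.of_associative_ring_bracket, TensorProduct.sub_tmul,
          TensorProduct.tmul_sub, add_mul, mul_add, Algebra.TensorProduct.tmul_mul_tmul, mul_one,
          one_mul]
        abel }

/-- The counit of the enveloping algebra, which vanishes on the Lie algebra. -/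
def envCounit : Env R L →ₐ[R] R := UniversalEnvelopingAlgebra.lift R 0

lemma envComul_ι (x : L) : envComul R L (UniversalEnvelopingAlgebra.ι R x) =
    UniversalEnvelopingAlgebra.ι R x ⊗ₜ[R] (1 : Env R L) +
      (1 : Env R L) ⊗ₜ[R] UniversalEnvelopingAlgebra.ι R x :=
  UniversalEnvelopingAlgebra.lift_ι_apply R _ x

lemma envCounit_ι (x : L) : envCounit R L (UniversalEnvelopingAlgebra.ι R x) = 0 :=
  UniversalEnvelopingAlgebra.lift_ι_apply R _ x

/-- The antipode of the enveloping algebra as an anti-homomorphism, `S(x) = -x` for `x` in the Lie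
algebra. -/
def envAntipode : Env R L →ₐ[R] (Env R L)ᵐᵒᵖ :=
  UniversalEnvelopingAlgebra.lift R
    { toFun := fun x => MulOpposite.op (-UniversalEnvelopingAlgebra.ι R x)
      map_add' := fun x y => by
        rw [map_add, ← MulOpposite.op_add, neg_add]
      map_smul' := fun c x => by
        rw [map_smul, ← smul_neg, MulOpposite.op_smul, RingHom.id_apply]
      map_lie' := fun {x y} => by
        simp only [LieHom.map_lie, LieRing.of_associative_ring_bracket, ← MulOpposite.op_mul,
          ← MulOpposite.op_sub, neg_mul_neg, neg_sub] }

lemma env_hom_ext {A : Type*} [Ring A] [Algebra R A] {f g : Env R L →ₐ[R] A}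
    (h : ∀ x, f (UniversalEnvelopingAlgebra.ι R x) = g (UniversalEnvelopingAlgebra.ι R x)) :
    f = g := by
  apply UniversalEnvelopingAlgebra.hom_ext
  ext x
  exact h x

instance envBialgebra : Bialgebra R (Env R L) :=
  .ofAlgHom (envComul R L) (envCounit R L)
    (env_hom_ext R L fun x => by
      simp [-UniversalEnvelopingAlgebra.ι_apply, envComul_ι, Algebra.TensorProduct.one_def,
        TensorProduct.add_tmul, TensorProduct.tmul_add]
      abel)
    (env_hom_ext R L fun x => by
      simp [-UniversalEnvelopingAlgebra.ι_apply, envComul_ι, envCounit_ι])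
    (env_hom_ext R L fun x => by
      simp [-UniversalEnvelopingAlgebra.ι_apply, envComul_ι, envCounit_ι])

lemma env_induction {p : Env R L → Prop} (hι : ∀ x, p (UniversalEnvelopingAlgebra.ι R x))
    (hr : ∀ r, p (algebraMap R (Env R L) r)) (hadd : ∀ a b, p a → p b → p (a + b))
    (hmul : ∀ a b, p a → p b → p (a * b)) (a : Env R L) : p a := by
  let S : Subalgebra R (Env R L) :=
    { carrier := {a | p a}
      mul_mem' := fun {a b} ha hb => hmul a b ha hb
      add_mem' := fun {a b} ha hb => hadd a b ha hb
      algebraMap_mem' := hr }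
  let f : Env R L →ₐ[R] S := UniversalEnvelopingAlgebra.lift R
    { toFun := fun x => ⟨UniversalEnvelopingAlgebra.ι R x, hι x⟩
      map_add' := fun x y => Subtype.ext (map_add _ x y)
      map_smul' := fun c x => Subtype.ext (map_smul _ c x)
      map_lie' := fun {x y} => Subtype.ext (LieHom.map_lie _ x y) }
  have hf : S.val.comp f = AlgHom.id R (Env R L) := env_hom_ext R L fun x => by
    have := UniversalEnvelopingAlgebra.lift_ι_apply R
      ({ toFun := fun x => ⟨UniversalEnvelopingAlgebra.ι R x, hι x⟩
         map_add' := fun x y => Subtype.ext (map_add _ x y)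
         map_smul' := fun c x => Subtype.ext (map_smul _ c x)
         map_lie' := fun {x y} => Subtype.ext (LieHom.map_lie _ x y) } : L →ₗ⁅R⁆ S) x
    exact congrArg Subtype.val this
  have := AlgHom.congr_fun hf a
  rw [AlgHom.comp_apply, AlgHom.id_apply] at this
  rw [← this]
  exact (f a).2

/-- The antipode as a linear map. -/
def envS : Env R L →ₗ[R] Env R L :=
  (MulOpposite.opLinearEquiv R).symm.toLinearMap ∘ₗ (envAntipode R L).toLinearMap

lemma envS_mul (a b : Env R L) : envS R L (a * b) = envS R L b * envS R L a := by
  simp [envS]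

lemma envS_algebraMap (r : R) : envS R L (algebraMap R (Env R L) r) = algebraMap R (Env R L) r := by
  simp [envS]

lemma envS_one : envS R L 1 = 1 := by
  simp [envS]

lemma envS_ι (x : L) : envS R L (UniversalEnvelopingAlgebra.ι R x) =
    -UniversalEnvelopingAlgebra.ι R x := by
  change MulOpposite.unop (envAntipode R L _) = _
  rw [envAntipode, UniversalEnvelopingAlgebra.lift_ι_apply]
  rfl

instance envHopfAlgebra : HopfAlgebra R (Env R L) where
  antipode := envS R L
  mul_antipode_rTensor_comul := by
    set φ : Env R L ⊗[R] Env R L →ₗ[R] Env R L := LinearMap.mul' R (Env R L) ∘ₗ (envS R L).rTensor (Env R L) with hφ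
    have h1 : ∀ (t : Env R L ⊗[R] Env R L) (b c : Env R L), φ (t * b ⊗ₜ c) = envS R L b * φ t * c := by
      intro t b c
      induction t with
      | zero => simp
      | add x y hx hy => rw [add_mul, map_add, hx, hy, map_add, mul_add, add_mul]
      | tmul x y => simp [hφ, envS_mul, mul_assoc]
    have h2 : ∀ (t u : Env R L ⊗[R] Env R L) (r : R), φ t = algebraMap R (Env R L) r → φ (t * u) = r • φ u := by
      intro t u r ht
      induction u with
      | zero => simp
      | add x y hx hy => rw [mul_add, map_add, hx, hy, map_add, smul_add]
      | tmul x y =>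
        rw [h1, ht, ← Algebra.commutes, mul_assoc, ← Algebra.smul_def]
        simp [hφ]
    ext a
    change φ (envComul R L a) = algebraMap R (Env R L) (envCounit R L a)
    induction a using env_induction R L with
    | hι x => 
      simp [-UniversalEnvelopingAlgebra.ι_apply, hφ, envComul_ι, envCounit_ι, envS_ι, envS_one]
    | hr r => simp [hφ, envS_algebraMap]
    | hadd a b ha hb => simp only [map_add, ha, hb]
    | hmul a b ha hb =>
      rw [map_mul, h2 _ _ _ ha, hb, map_mul, map_mul, Algebra.smul_def]
  mul_antipode_lTensor_comul := by
    set φ : Env R L ⊗[R] Env R L →ₗ[R] Env R L := LinearMap.mul' R (Env R L) ∘ₗ (envS R L).lTensor (Env R L) with hφ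
    have h1 : ∀ (t : Env R L ⊗[R] Env R L) (b c : Env R L), φ (b ⊗ₜ c * t) = b * φ t * envS R L c := by
      intro t b c
      induction t with
      | zero => simp
      | add x y hx hy => rw [mul_add, map_add, hx, hy, map_add, mul_add, add_mul]
      | tmul x y => simp [hφ, envS_mul, mul_assoc]
    have h2 : ∀ (t u : Env R L ⊗[R] Env R L) (r : R), φ u = algebraMap R (Env R L) r → φ (t * u) = r • φ t := by
      intro t u r hu
      induction t with
      | zero => simp
      | add x y hx hy => rw [add_mul, map_add, hx, hy, map_add, smul_add]
      | tmul x y =>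
        rw [h1, hu, ← Algebra.commutes, mul_assoc, ← Algebra.smul_def]
        simp [hφ]
    ext a
    change φ (envComul R L a) = algebraMap R (Env R L) (envCounit R L a)
    induction a using env_induction R L with
    | hι x => 
      simp [-UniversalEnvelopingAlgebra.ι_apply, hφ, envComul_ι, envCounit_ι, envS_ι, envS_one]
    | hr r => simp [hφ, envS_one]
    | hadd a b ha hb => simp only [map_add, ha, hb]
    | hmul a b ha hb =>
      rw [map_mul, h2 _ _ _ hb, ha, map_mul, mul_comm, map_mul, Algebra.smul_def]

end Enveloping
/-! ### The Lie algebra and its enveloping algebra -/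

/-- The generators `Z` and `X_n`, `n ∈ ℤ`. -/
inductive LieGen : Type
  | Z : LieGen
  | X : ℤ → LieGen

/-- The relators `[Z, X_n] - (n + 1) X_n` and `[X_n, X_{n'}]`. -/
def lieRel : Set (FreeLieAlgebra ℂ LieGen) :=
  (Set.range fun n : ℤ => ⁅FreeLieAlgebra.of ℂ LieGen.Z, FreeLieAlgebra.of ℂ (LieGen.X n)⁆ -
    ((n : ℂ) + 1) • FreeLieAlgebra.of ℂ (LieGen.X n)) ∪
  Set.range fun p : ℤ × ℤ =>
    ⁅FreeLieAlgebra.of ℂ (LieGen.X p.1), FreeLieAlgebra.of ℂ (LieGen.X p.2)⁆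

/-- The Lie algebra `𝔩_ℤ` with generators `Z`, `X_n` and relations `[Z, X_n] = (n + 1) X_n`,
`[X_n, X_{n'}] = 0`. -/
abbrev lZ : Type := FreeLieAlgebra ℂ LieGen ⧸
  LieSubmodule.lieSpan ℂ (FreeLieAlgebra ℂ LieGen) lieRel

/-- The image of a generator in `𝔩_ℤ`. -/
def lgen (g : LieGen) : lZ := LieSubmodule.Quotient.mk (FreeLieAlgebra.of ℂ g)

/-- The enveloping algebra `𝔥_ℤ` of `𝔩_ℤ`. -/
abbrev hZ : Type := UniversalEnvelopingAlgebra ℂ lZ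

/-- The image of a generator in `𝔥_ℤ`. -/
def hgen (g : LieGen) : hZ := UniversalEnvelopingAlgebra.ι ℂ (lgen g)

/-- The generators of `𝔥_ℤ` are primitive. -/
lemma comul_hgen (g : LieGen) : Coalgebra.comul (R := ℂ) (hgen g) =
    hgen g ⊗ₜ[ℂ] (1 : hZ) + (1 : hZ) ⊗ₜ[ℂ] hgen g :=
  envComul_ι ℂ lZ (lgen g)

/-- For an action of `𝔥_ℤ` on `ℚ_σ(Γ(N))`, the linear map
`𝔥_ℤ ⊗ 𝔥_ℤ → ℚ_σ(Γ(N))`, `a ⊗ b ↦ (a(F₁), b(F₂))`. -/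
def pairAct (N : ℕ) [NeZero N] (σ : SL(2, ℤ)) (act : hZ →ₐ[ℂ] Module.End ℂ (QQ N σ))
    (F₁ F₂ : QQ N σ) : hZ ⊗[ℂ] hZ →ₗ[ℂ] QQ N σ :=
  TensorProduct.lift ((pairing N σ).compl₁₂
    (LinearMap.applyₗ F₁ ∘ₗ act.toLinearMap) (LinearMap.applyₗ F₂ ∘ₗ act.toLinearMap))

lemma pairAct_tmul {N : ℕ} [NeZero N] {σ : SL(2, ℤ)} (act : hZ →ₐ[ℂ] Module.End ℂ (QQ N σ))
    (F₁ F₂ : QQ N σ) (a b : hZ) :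
    pairAct N σ act F₁ F₂ (a ⊗ₜ[ℂ] b) = pairing N σ (act a F₁) (act b F₂) := rfl

end QuasiHecke

end

/-!
Call an endomorphism `D` of `ℚ_σ(Γ)` a derivation of the pairing if
`D(F¹, F²) = (D(F¹), F²) + (F¹, D(F²))`.

On the quasimodular tower `X` and `Y` are derivations which commute with every multiplicative
operation `f ↦ f || γ`, and `[Y, X] = X`. As the matrices `ρ_m` commute with each other, applying
`X(·) || ρ_n⁻¹` or `Y` to a summand of the pairing gives the two summands in which one of the
arguments has been replaced by its image under `X_n` or `Y`; moreover the degree is additive under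
the pairing. Hence `X_n` and `Z` are derivations of the pairing. Since they satisfy the relations of
`𝔩_ℤ` and derivations form a Lie algebra, all of `𝔩_ℤ` acts by derivations, that is, by maps
`x` with `x ∘ B = B ∘ (x ⊗ 1 + 1 ⊗ x)` for the pairing `B : V ⊗ V → V`. The elements of `𝔥_ℤ`
whose action on `V ⊗ V` (through the coproduct) and on `V` are intertwined by `B` form a
subalgebra; it contains `𝔩_ℤ`, so it is everything.
-/

noncomputable section

namespace QuasiHecke

section BilinearMaps

variable {R : Type*} [CommSemiring R]

/-- An endomorphism `D` is a derivation of the bilinear map `B`, that is, of the not necessarily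
associative algebra `(V, B)`. -/
def IsBilinDerivation {V : Type*} [AddCommMonoid V] [Module R V] (B : V →ₗ[R] V →ₗ[R] V)
    (D : Module.End R V) : Prop :=
  ∀ x y, D (B x y) = B (D x) y + B x (D y)

lemma isBilinDerivation_of_lof {ι : Type*} [DecidableEq ι] {M : ι → Type*}
    [∀ i, AddCommMonoid (M i)] [∀ i, Module R (M i)]
    {B : (⨁ i, M i) →ₗ[R] (⨁ i, M i) →ₗ[R] ⨁ i, M i} {D : Module.End R (⨁ i, M i)}
    (h : ∀ i j (x : M i) (y : M j),
      D (B (DirectSum.lof R ι M i x) (DirectSum.lof R ι M j y)) =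
        B (D (DirectSum.lof R ι M i x)) (DirectSum.lof R ι M j y) +
          B (DirectSum.lof R ι M i x) (D (DirectSum.lof R ι M j y))) :
    IsBilinDerivation B D := by
  intro x y
  induction x using DirectSum.induction_on with
  | zero => simp only [map_zero, LinearMap.zero_apply, add_zero]
  | add x x' hx hx' => simp only [map_add, LinearMap.add_apply, hx, hx']; abel
  | of i x =>
    induction y using DirectSum.induction_on with
    | zero => simp only [map_zero, add_zero]
    | add y y' hy hy' => simp only [map_add, hy, hy']; abel
    | of j y => exact h i j x y

/-- The representation of `A ⊗ A` on `V ⊗ V` given by a representation of the algebra `A` on `V`. -/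
def tensorAct {A V : Type*} [Semiring A] [Algebra R A] [AddCommMonoid V] [Module R V]
    (act : A →ₐ[R] Module.End R V) : A ⊗[R] A →ₐ[R] Module.End R (V ⊗[R] V) :=
  Module.endTensorEndAlgHom.comp (Algebra.TensorProduct.map act act)

lemma tensorAct_tmul_tmul {A V : Type*} [Semiring A] [Algebra R A] [AddCommMonoid V] [Module R V]
    (act : A →ₐ[R] Module.End R V) (a b : A) (x y : V) :
    tensorAct act (a ⊗ₜ[R] b) (x ⊗ₜ[R] y) = act a x ⊗ₜ[R] act b y :=
  rfl

/-- The elements of `A` whose actions on `W` and `V` are intertwined by the linear map `f`. -/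
def intertwined {A W V : Type*} [Semiring A] [Algebra R A] [AddCommMonoid W] [Module R W]
    [AddCommMonoid V] [Module R V] (f : W →ₗ[R] V) (ρ : A →ₐ[R] Module.End R W)
    (π : A →ₐ[R] Module.End R V) : Subalgebra R A where
  carrier := {a | ∀ w, π a (f w) = f (ρ a w)}
  mul_mem' {a b} ha hb w := by
    rw [map_mul, map_mul, Module.End.mul_apply, Module.End.mul_apply, hb w, ha]
  add_mem' {a b} ha hb w := by
    rw [map_add, map_add, LinearMap.add_apply, LinearMap.add_apply, map_add, ha w, hb w]
  algebraMap_mem' r w := by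
    rw [AlgHom.commutes, AlgHom.commutes, Module.algebraMap_end_apply,
      Module.algebraMap_end_apply, map_smul]

end BilinearMaps

section EnvelopingAlgebra

variable {R : Type*} [CommRing R]

attribute [local instance] LieRing.ofAssociativeRing

/-- The Lie algebra of derivations of a bilinear map. -/
def bilinDerivations {V : Type*} [AddCommGroup V] [Module R V] (B : V →ₗ[R] V →ₗ[R] V) :
    LieSubalgebra R (Module.End R V) where
  carrier := {D | IsBilinDerivation B D}
  add_mem' {D E} hD hE x y := by
    simp only [LinearMap.add_apply, map_add, hD x y, hE x y]; abel
  zero_mem' x y := by simp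
  smul_mem' c D hD x y := by
    simp only [LinearMap.smul_apply, map_smul, hD x y, smul_add]
  lie_mem' {D E} hD hE x y := by
    have hD : IsBilinDerivation B D := hD
    have hE : IsBilinDerivation B E := hE
    simp only [LieRing.of_associative_ring_bracket, LinearMap.sub_apply, Module.End.mul_apply,
      map_sub, map_add, hD _ _, hE _ _]
    abel

variable {L : Type*} [LieRing L] [LieAlgebra R L]

lemma subalgebra_env_eq_top {S : Subalgebra R (Env R L)}
    (h : ∀ x, UniversalEnvelopingAlgebra.ι R x ∈ S) : S = ⊤ :=
  Algebra.eq_top_iff.2 fun a => env_induction R L (p := (· ∈ S)) h S.algebraMap_mem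
    (fun _ _ => S.add_mem) (fun _ _ => S.mul_mem) a

variable {V : Type*} [AddCommMonoid V] [Module R V] {B : V →ₗ[R] V →ₗ[R] V}
  {act : Env R L →ₐ[R] Module.End R V}

lemma env_act_lift_eq_lift_tensorAct_comul
    (hact : ∀ x, IsBilinDerivation B (act (UniversalEnvelopingAlgebra.ι R x))) (h : Env R L)
    (t : V ⊗[R] V) :
    act h (TensorProduct.lift B t) =
      TensorProduct.lift B (tensorAct act (Coalgebra.comul (R := R) h) t) := by
  let S := intertwined (TensorProduct.lift B)
    ((tensorAct act).comp (Bialgebra.comulAlgHom R (Env R L))) act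
  have hS : S = ⊤ := subalgebra_env_eq_top fun x t => by
    have hx : Bialgebra.comulAlgHom R (Env R L) (UniversalEnvelopingAlgebra.ι R x) =
        UniversalEnvelopingAlgebra.ι R x ⊗ₜ[R] 1 + 1 ⊗ₜ[R] UniversalEnvelopingAlgebra.ι R x :=
      envComul_ι R L x
    rw [AlgHom.comp_apply, hx]
    induction t with
    | zero => simp only [map_zero]
    | add t u ht hu => simp only [map_add] at ht hu ⊢; rw [ht, hu]
    | tmul v w =>
      rw [TensorProduct.lift.tmul, hact x v w, map_add, LinearMap.add_apply, tensorAct_tmul_tmul,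
        tensorAct_tmul_tmul, map_one, map_add, TensorProduct.lift.tmul, TensorProduct.lift.tmul,
        Module.End.one_apply, Module.End.one_apply]
  exact (hS.ge trivial : h ∈ S) t

end EnvelopingAlgebra

section LieAlgebraQuotient

/-- A Lie algebra morphism that kills an ideal factors through the quotient. -/
def lieQuotientLift {R L M : Type*} [CommRing R] [LieRing L] [LieAlgebra R L] [LieRing M]
    [LieAlgebra R M] (I : LieIdeal R L) (f : L →ₗ⁅R⁆ M) (h : I ≤ f.ker) : L ⧸ I →ₗ⁅R⁆ M :=
  { I.toSubmodule.liftQ (f : L →ₗ[R] M) h with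
    map_lie' := fun {x y} => by
      obtain ⟨x, rfl⟩ := LieSubmodule.Quotient.surjective_mk' I x
      obtain ⟨y, rfl⟩ := LieSubmodule.Quotient.surjective_mk' I y
      exact f.map_lie x y }

variable {M : Type*} [LieRing M] [LieAlgebra ℂ M]

/-- The universal property of the presentation of `𝔩_ℤ`. -/
def lZLift (D : LieGen → M)
    (hZX : ∀ n : ℤ, ⁅D LieGen.Z, D (LieGen.X n)⁆ = ((n : ℂ) + 1) • D (LieGen.X n))
    (hXX : ∀ n n' : ℤ, ⁅D (LieGen.X n), D (LieGen.X n')⁆ = 0) : lZ →ₗ⁅ℂ⁆ M :=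
  lieQuotientLift _ (FreeLieAlgebra.lift ℂ D) <| by
    rw [LieSubmodule.lieSpan_le]
    rintro _ (⟨n, rfl⟩ | ⟨⟨n, n'⟩, rfl⟩)
    · rw [SetLike.mem_coe, LieHom.mem_ker, map_sub, map_smul, LieHom.map_lie,
        FreeLieAlgebra.lift_of_apply, FreeLieAlgebra.lift_of_apply, hZX, sub_self]
    · rw [SetLike.mem_coe, LieHom.mem_ker, LieHom.map_lie, FreeLieAlgebra.lift_of_apply,
        FreeLieAlgebra.lift_of_apply, hXX]

lemma lZLift_lgen (D : LieGen → M) (hZX) (hXX) (g : LieGen) : lZLift D hZX hXX (lgen g) = D g :=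
  FreeLieAlgebra.lift_of_apply D g

end LieAlgebraQuotient

section DirectSum

variable {ι R M : Type*} [DecidableEq ι] [Semiring R] [AddCommMonoid M] [Module R M]
  {p : ι → Submodule R M}

lemma lof_eq_lof_of_coe_eq {i j : ι} (h : i = j) {x : p i} {y : p j} (hxy : (x : M) = y) :
    DirectSum.lof R ι (fun i => p i) i x = DirectSum.lof R ι (fun i => p i) j y := by
  subst h
  rw [Subtype.ext hxy]

lemma lof_eq_lof_add_lof {i j k : ι} (hj : i = j) (hk : i = k) {x : p i} {y : p j} {z : p k}
    (hx : (x : M) = y + z) :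
    DirectSum.lof R ι (fun i => p i) i x =
      DirectSum.lof R ι (fun i => p i) j y + DirectSum.lof R ι (fun i => p i) k z := by
  subst hj hk
  rw [← map_add]
  exact lof_eq_lof_of_coe_eq rfl hx

end DirectSum

section Tower

lemma ramanujan_mul {v w : ℤ} {f g : ℍ → ℂ} (hf : MDiff f) (hg : MDiff g) :
    ramanujan (v + w) (f * g) = ramanujan v f * g + f * ramanujan w g := by
  rw [ramanujan_eq, ramanujan_eq, ramanujan_eq, Int.cast_add,
    Derivative.serreDerivative_mul _ _ _ _ hf hg]

/-- The product of the coefficients of `G₂ ^ i` and `G₂ ^ j` in quasimodular forms of weights `k`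
and `l`, as a coefficient of `G₂ ^ (i + j)` in weight `k + l`. -/
def modMul {k l i j : ℕ} (a : modTower ((k : ℤ) - 2 * (i : ℤ)))
    (b : modTower ((l : ℤ) - 2 * (j : ℤ))) :
    modTower (((k + l : ℕ) : ℤ) - 2 * ((i + j : ℕ) : ℤ)) :=
  ⟨(a : ℍ → ℂ) * b, by
    convert modTower_mul a.2 b.2 using 1
    push_cast
    ring_nf⟩

lemma gen_mul_gen (k l i j : ℕ) (a : modTower ((k : ℤ) - 2 * (i : ℤ)))
    (b : modTower ((l : ℤ) - 2 * (j : ℤ))) :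
    gen k i a * gen l j b = gen (k + l) (i + j) (modMul a b) :=
  gen_mul k l i j a b _ rfl

lemma gen_smul (k i : ℕ) (c : ℂ) (a : modTower ((k : ℤ) - 2 * (i : ℤ))) :
    gen k i (c • a) = c • gen k i a := by
  simp only [gen, map_smul]

lemma gen_eq_gen_add_gen {k l m : ℕ} (hl : k = l) (hm : k = m) {i : ℕ}
    {a : modTower ((k : ℤ) - 2 * (i : ℤ))} {b : modTower ((l : ℤ) - 2 * (i : ℤ))}
    {c : modTower ((m : ℤ) - 2 * (i : ℤ))} (h : (a : ℍ → ℂ) = b + c) :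
    gen k i a = gen l i b + gen m i c := by
  refine lof_eq_lof_add_lof hl hm ?_
  change (a : ℍ → ℂ) * eisG2 ^ i = b * eisG2 ^ i + c * eisG2 ^ i
  rw [h, add_mul]

lemma QM_mul_smul (c : ℂ) (f g : QM) : f * (c • g) = c • (f * g) := by
  rw [mul_comm, QM_smul_mul, mul_comm]

lemma QM_leibniz_of_gen (L : QM →ₗ[ℂ] QM)
    (h : ∀ k l i j a b,
      L (gen k i a * gen l j b) = L (gen k i a) * gen l j b + gen k i a * L (gen l j b))
    (f g : QM) : L (f * g) = L f * g + f * L g := by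
  induction f using QM_induction with
  | h0 => simp only [zero_mul, map_zero, add_zero]
  | hadd f f' hf hf' => simp only [add_mul, map_add, hf, hf']; abel
  | hgen k i a =>
    induction g using QM_induction with
    | h0 => simp only [mul_zero, map_zero, add_zero]
    | hadd g g' hg hg' => simp only [mul_add, map_add, hg, hg']; abel
    | hgen l j b => exact h k l i j a b

lemma XQM_mul (f g : QM) : XQM (f * g) = XQM f * g + f * XQM g := by
  refine QM_leibniz_of_gen XQM (fun k l i j a b => ?_) f g
  rw [gen_mul_gen, XQM_gen, XQM_gen, XQM_gen, gen_mul_gen, gen_mul_gen]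
  refine gen_eq_gen_add_gen (by omega) (by omega) ?_
  change ramanujan _ ((a : ℍ → ℂ) * b) = ramanujan _ (a : ℍ → ℂ) * b + a * ramanujan _ (b : ℍ → ℂ)
  rw [← ramanujan_mul (modTower_holo a.2) (modTower_holo b.2)]
  congr 1
  push_cast
  ring

lemma YQM_gen_eq_smul (k i : ℕ) (a : modTower ((k : ℤ) - 2 * (i : ℤ))) :
    YQM (gen k i a) = ((k : ℂ) / 2 - i) • gen k i a := by
  rw [YQM_gen, modY, LinearMap.smul_apply, LinearMap.id_apply, gen_smul]
  congr 1
  push_cast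
  ring

lemma YQM_mul (f g : QM) : YQM (f * g) = YQM f * g + f * YQM g := by
  refine QM_leibniz_of_gen YQM (fun k l i j a b => ?_) f g
  rw [YQM_gen_eq_smul, YQM_gen_eq_smul, QM_smul_mul, QM_mul_smul, ← add_smul, gen_mul_gen,
    YQM_gen_eq_smul]
  congr 1
  push_cast
  ring

lemma YQM_XQM (f : QM) : YQM (XQM f) = XQM (YQM f) + XQM f := by
  have h : YQM ∘ₗ XQM = XQM ∘ₗ YQM + XQM := QM_hom_ext fun k i a => by
    rw [LinearMap.add_apply, LinearMap.comp_apply, LinearMap.comp_apply, XQM_gen,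
      YQM_gen_eq_smul, YQM_gen_eq_smul, map_smul, XQM_gen]
    push_cast
    module
  exact LinearMap.congr_fun h f

end Tower

section Operators

lemma Xop_lof {N : ℕ} {σ : SL(2, ℤ)} (n m : ℤ) (F : heckeGr N σ m) :
    Xop N σ n (DirectSum.lof ℂ ℤ (fun m => heckeGr N σ m) m F) =
      DirectSum.lof ℂ ℤ (fun m => heckeGr N σ m) (m + n)
        (Xtau N (rho m * σ) (rho n) (rho (m + n) * σ)
          (by rw [add_comm, rho_add, mul_assoc]) F) := by
  rw [Xop, DirectSum.toModule_lof, LinearMap.comp_apply]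

lemma Zop_lof {N : ℕ} {σ : SL(2, ℤ)} (m : ℤ) (F : heckeGr N σ m) :
    Zop N σ (DirectSum.lof ℂ ℤ (fun m => heckeGr N σ m) m F) =
      DirectSum.lof ℂ ℤ (fun m => heckeGr N σ m) m
        ((m : ℂ) • F + Yhecke N (rho m * σ) F) := by
  rw [Zop, DirectSum.lmap_lof, LinearMap.add_apply, LinearMap.smul_apply, LinearMap.id_apply]

lemma Xtau_apply {N : ℕ} {σ τ σ' : SL(2, ℤ)} (h : σ' = τ * σ) (F : twistedHecke N σ)
    (α : GL(2, ℚ)⁺) :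
    (Xtau N σ τ σ' h F : GL(2, ℚ)⁺ → QM) α = slashQM τ⁻¹ (XQM ((F : GL(2, ℚ)⁺ → QM) α)) :=
  rfl

lemma Yhecke_apply {N : ℕ} {σ : SL(2, ℤ)} (F : twistedHecke N σ) (α : GL(2, ℚ)⁺) :
    (Yhecke N σ F : GL(2, ℚ)⁺ → QM) α = YQM ((F : GL(2, ℚ)⁺ → QM) α) :=
  rfl

lemma Xop_comm (N : ℕ) (σ : SL(2, ℤ)) (n n' : ℤ) :
    Xop N σ n * Xop N σ n' = Xop N σ n' * Xop N σ n := by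
  refine DirectSum.linearMap_ext ℂ fun m => LinearMap.ext fun F => ?_
  simp only [LinearMap.comp_apply, Module.End.mul_apply, Xop_lof]
  refine lof_eq_lof_of_coe_eq (add_right_comm m n' n) (funext fun α => ?_)
  simp only [Xtau_apply, slashQM_XQM, slashQM_slashQM, ← mul_inv_rev, rho_comm n n']

lemma Zop_mul_Xop (N : ℕ) (σ : SL(2, ℤ)) (n : ℤ) :
    Zop N σ * Xop N σ n = Xop N σ n * Zop N σ + ((n : ℂ) + 1) • Xop N σ n := by
  refine DirectSum.linearMap_ext ℂ fun m => LinearMap.ext fun F => ?_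
  simp only [LinearMap.comp_apply, LinearMap.add_apply, LinearMap.smul_apply,
    Module.End.mul_apply, Xop_lof, Zop_lof, ← map_smul, ← map_add]
  refine lof_eq_lof_of_coe_eq rfl (funext fun α => ?_)
  simp only [Submodule.coe_add, Submodule.coe_smul, Pi.add_apply, Pi.smul_apply, Xtau_apply,
    Yhecke_apply, ← slashQM_YQM, YQM_XQM, map_add, map_smul]
  push_cast
  module

end Operators

section Pairing

variable {N : ℕ} [NeZero N] {σ τ τ₁ τ₂ : SL(2, ℤ)}

lemma slashQM_XQM_pairTerm (h : Commute τ τ₂) (F G : GL(2, ℚ)⁺ → QM) (α : GL(2, ℚ)⁺)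
    (β : SL(2, ℤ)) :
    slashQM τ⁻¹ (XQM (pairTerm σ τ₁ τ₂ F G α β)) =
      pairTerm σ (τ * τ₁) τ₂ (fun α => slashQM τ⁻¹ (XQM (F α))) G α β +
        pairTerm σ τ₁ (τ * τ₂) F (fun α => slashQM τ⁻¹ (XQM (G α))) α β := by
  have h₁ : τ₂⁻¹ * τ⁻¹ = τ⁻¹ * τ₂⁻¹ := h.symm.inv_inv
  have h₂ : τ₂ * σ * β * τ₁⁻¹ * τ₂⁻¹ * τ⁻¹ = τ₂ * σ * β * (τ * τ₁)⁻¹ * τ₂⁻¹ := by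
    rw [mul_inv_rev]
    simp only [mul_assoc, h₁]
  have h₃ : τ⁻¹ * (τ * τ₂ * σ * β * τ₁⁻¹ * (τ * τ₂)⁻¹) = τ₂ * σ * β * τ₁⁻¹ * τ₂⁻¹ * τ⁻¹ := by
    group
  simp only [pairTerm, XQM_mul, map_add, slashQM_mul, slashQM_XQM, slashQM_slashQM]
  rw [h₃, h₁, ← h₂, mul_inv_rev, h₁]

lemma YQM_pairTerm (F G : GL(2, ℚ)⁺ → QM) (α : GL(2, ℚ)⁺) (β : SL(2, ℤ)) :
    YQM (pairTerm σ τ₁ τ₂ F G α β) =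
      pairTerm σ τ₁ τ₂ (fun α => YQM (F α)) G α β +
        pairTerm σ τ₁ τ₂ F (fun α => YQM (G α)) α β := by
  simp only [pairTerm, YQM_mul, slashQM_YQM]

lemma map_pairFun_eq_add {τ₃ τ₄ τ₅ τ₆ : SL(2, ℤ)} {F₁ : twistedHecke N (τ₁ * σ)}
    {F₂ : twistedHecke N (τ₂ * σ)} {F₃ : twistedHecke N (τ₃ * σ)} {F₄ : twistedHecke N (τ₄ * σ)}
    {F₅ : twistedHecke N (τ₅ * σ)} {F₆ : twistedHecke N (τ₆ * σ)} (L : QM →ₗ[ℂ] QM)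
    (α : GL(2, ℚ)⁺)
    (h : ∀ β, L (pairTerm σ τ₁ τ₂ F₁ F₂ α β) =
      pairTerm σ τ₃ τ₄ F₃ F₄ α β + pairTerm σ τ₅ τ₆ F₅ F₆ α β) :
    L (pairFun N σ τ₁ τ₂ F₁ F₂ α) =
      pairFun N σ τ₃ τ₄ F₃ F₄ α + pairFun N σ τ₅ τ₆ F₅ F₆ α := by
  rw [pairFun, pairFun, pairFun, map_sum, ← Finset.sum_add_distrib]
  refine Finset.sum_congr rfl fun q _ => ?_
  induction q using Quotient.inductionOn with
  | h β => exact h β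

lemma slashQM_XQM_pairFun {τ₁' τ₂' : SL(2, ℤ)} (h₁ : τ₁' = τ * τ₁) (h₂ : τ₂' = τ * τ₂)
    (h : Commute τ τ₂) (F : twistedHecke N (τ₁ * σ)) (G : twistedHecke N (τ₂ * σ))
    (α : GL(2, ℚ)⁺) :
    slashQM τ⁻¹ (XQM (pairFun N σ τ₁ τ₂ F G α)) =
      pairFun N σ τ₁' τ₂ (Xtau N (τ₁ * σ) τ (τ₁' * σ) (by rw [h₁, mul_assoc]) F) G α +
        pairFun N σ τ₁ τ₂' F (Xtau N (τ₂ * σ) τ (τ₂' * σ) (by rw [h₂, mul_assoc]) G) α := by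
  subst h₁ h₂
  exact map_pairFun_eq_add (slashQM τ⁻¹ ∘ₗ XQM) α (slashQM_XQM_pairTerm h F G α)

lemma Yhecke_pairMap {σ' : SL(2, ℤ)} (hτ : τ₁ * τ₂ = τ₂ * τ₁) (h : σ' = τ₁ * τ₂ * σ)
    (F : twistedHecke N (τ₁ * σ)) (G : twistedHecke N (τ₂ * σ)) :
    Yhecke N σ' (pairMap N σ τ₁ τ₂ σ' hτ h F G) =
      pairMap N σ τ₁ τ₂ σ' hτ h (Yhecke N (τ₁ * σ) F) G +
        pairMap N σ τ₁ τ₂ σ' hτ h F (Yhecke N (τ₂ * σ) G) :=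
  Subtype.ext <| funext fun α => map_pairFun_eq_add YQM α (YQM_pairTerm F G α)

variable (N σ)

lemma isBilinDerivation_Xop (n : ℤ) : IsBilinDerivation (pairing N σ) (Xop N σ n) := by
  refine isBilinDerivation_of_lof fun l m F G => ?_
  simp only [pairing_lof, Xop_lof]
  refine lof_eq_lof_add_lof (add_right_comm l m n) (add_assoc l m n) (funext fun α => ?_)
  exact slashQM_XQM_pairFun (by rw [add_comm, rho_add]) (by rw [add_comm, rho_add])
    (rho_comm n m) F G α

lemma isBilinDerivation_Zop : IsBilinDerivation (pairing N σ) (Zop N σ) := by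
  refine isBilinDerivation_of_lof fun m n F G => ?_
  simp only [pairing_lof, Zop_lof, ← map_add]
  congr 1
  simp only [Yhecke_pairMap, map_add, map_smul, LinearMap.add_apply, LinearMap.smul_apply]
  push_cast
  module

end Pairing

section Action

variable (N : ℕ) [NeZero N] (σ : SL(2, ℤ))

attribute [local instance] LieRing.ofAssociativeRing

/-- Instance search finds no subtraction on `ℚ_σ(Γ(N))`, which is built over the additive monoid of
the semiring `QM`; this one, `x - y = x + (-1) • y`, leaves the additive monoid unchanged. -/
abbrev addCommGroupQQ : AddCommGroup (QQ N σ) := Module.addCommMonoidToAddCommGroup ℂ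

attribute [local instance] addCommGroupQQ

/-- The action of `𝔩_ℤ` on `ℚ_σ(Γ(N))` by derivations of the pairing. -/
def lieAction : lZ →ₗ⁅ℂ⁆ bilinDerivations (pairing N σ) :=
  lZLift
    (fun
      | .Z => ⟨Zop N σ, isBilinDerivation_Zop N σ⟩
      | .X n => ⟨Xop N σ n, isBilinDerivation_Xop N σ n⟩)
    (fun n => Subtype.ext (sub_eq_iff_eq_add'.2 (Zop_mul_Xop N σ n)))
    (fun n n' => Subtype.ext (sub_eq_zero.2 (Xop_comm N σ n n')))

/-- The action of `𝔥_ℤ` on `ℚ_σ(Γ(N))`. -/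
def envAction : hZ →ₐ[ℂ] Module.End ℂ (QQ N σ) :=
  UniversalEnvelopingAlgebra.lift ℂ ((bilinDerivations (pairing N σ)).incl.comp (lieAction N σ))

lemma envAction_ι (x : lZ) :
    envAction N σ (UniversalEnvelopingAlgebra.ι ℂ x) = lieAction N σ x :=
  UniversalEnvelopingAlgebra.lift_ι_apply ℂ _ x

lemma envAction_hgen_X (n : ℤ) : envAction N σ (hgen (.X n)) = Xop N σ n := by
  rw [hgen, envAction_ι, lieAction, lZLift_lgen]

lemma envAction_hgen_Z : envAction N σ (hgen .Z) = Zop N σ := by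
  rw [hgen, envAction_ι, lieAction, lZLift_lgen]

variable {N σ}

lemma pairAct_eq_lift_tensorAct (act : hZ →ₐ[ℂ] Module.End ℂ (QQ N σ)) (F₁ F₂ : QQ N σ)
    (t : hZ ⊗[ℂ] hZ) :
    pairAct N σ act F₁ F₂ t =
      TensorProduct.lift (pairing N σ) (tensorAct act t (F₁ ⊗ₜ[ℂ] F₂)) := by
  induction t with
  | zero => simp only [map_zero, LinearMap.zero_apply]
  | add t u ht hu => simp only [map_add, LinearMap.add_apply, ht, hu]
  | tmul a b => rw [pairAct_tmul, tensorAct_tmul_tmul, TensorProduct.lift.tmul]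

lemma envAction_pairing (h : hZ) (F₁ F₂ : QQ N σ) :
    envAction N σ h (pairing N σ F₁ F₂) =
      pairAct N σ (envAction N σ) F₁ F₂ (Coalgebra.comul (R := ℂ) h) := by
  have hact (x : lZ) :
      IsBilinDerivation (pairing N σ) (envAction N σ (UniversalEnvelopingAlgebra.ι ℂ x)) := by
    rw [envAction_ι]
    exact (lieAction N σ x).2
  rw [pairAct_eq_lift_tensorAct, ← env_act_lift_eq_lift_tensorAct_comul hact,
    TensorProduct.lift.tmul]

end Action

end QuasiHecke

end

theorem mainTheorem3 (N : ℕ) [NeZero N] (σ : SL(2, ℤ)) :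
    ∃ act : QuasiHecke.hZ →ₐ[ℂ] Module.End ℂ (QuasiHecke.QQ N σ),
      (∀ n : ℤ, act (QuasiHecke.hgen (QuasiHecke.LieGen.X n)) = QuasiHecke.Xop N σ n) ∧
      act (QuasiHecke.hgen QuasiHecke.LieGen.Z) = QuasiHecke.Zop N σ ∧
      (∀ (h : QuasiHecke.hZ) (F₁ F₂ : QuasiHecke.QQ N σ),
        act h (QuasiHecke.pairing N σ F₁ F₂) =
          QuasiHecke.pairAct N σ act F₁ F₂ (Coalgebra.comul (R := ℂ) h)) ∧
      (∀ (n : ℤ) (F₁ F₂ : QuasiHecke.QQ N σ),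
        QuasiHecke.Xop N σ n (QuasiHecke.pairing N σ F₁ F₂) =
          QuasiHecke.pairing N σ (QuasiHecke.Xop N σ n F₁) F₂ +
            QuasiHecke.pairing N σ F₁ (QuasiHecke.Xop N σ n F₂)) ∧
      ∀ F₁ F₂ : QuasiHecke.QQ N σ,
        QuasiHecke.Zop N σ (QuasiHecke.pairing N σ F₁ F₂) =
          QuasiHecke.pairing N σ (QuasiHecke.Zop N σ F₁) F₂ +
            QuasiHecke.pairing N σ F₁ (QuasiHecke.Zop N σ F₂) :=
  ⟨QuasiHecke.envAction N σ, QuasiHecke.envAction_hgen_X N σ, QuasiHecke.envAction_hgen_Z N σ,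
    QuasiHecke.envAction_pairing, QuasiHecke.isBilinDerivation_Xop N σ,
    QuasiHecke.isBilinDerivation_Zop N σ⟩
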